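/- For $x\in L_2(0,1)$ (real-valued) let $[F(x)](s)=\int_0^s x(s-t)\,x(t)\,dt$, $s\in[0,1]$, be the autoconvolution operator. For $\sigma\ge 0$ put $\|x\|_\sigma=\big(\int_0^1 e^{-2\sigma t}x(t)^2\,dt\big)^{1/2}$, and let $\|x\|=\|x\|_0$ be the norm of $L_2(0,1)$. For $m\in\mathbb N$, $m\ge 1$, let $X_m^0$ be the space of functions that are constant on each cell $[\frac{i-1}{m},\frac im)$, $i=1,\dots,m$, and let $Q_m$ be the $L_2(0,1)$-orthogonal projection onto $X_m^0$ (mean values over the cells; it is in general not orthogonal with respect to the inner product of $\|\cdot\|_\sigma$ for $\sigma>0$). The function $Q_m y$ is evaluated at the point $1$ by its value on the last cell. Let $x_0\in W^2_\infty(0,1)$ be positive, with $x_0(0)>0$ (continuous representative). Then there are a weight $\sigma>0$ and constants $c,C>0$, depending only on $x_0$, such that the following holds for every $\delta\in(0,1]$, every $m\in\mathbb N$ with $m\delta\ge 1$, and every measurable $y^\delta$ with $\|y^\delta-F(x_0)\|_\infty\le\delta$. Let $x_*$ be the constant function $$x_*\equiv\begin{cases}\sqrt{\tfrac1{\sqrt\delta}\,[Q_my^\delta](\sqrt\delta)},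 & [Q_my^\delta](\sqrt\delta)\ge 0,\\ 0, &\text{otherwise.}\end{cases}$$ With $\alpha=c\sqrt\delta$, the discretized Lavrent'ev equation $$\alpha Q_m(x_*-x)+Q_my^\delta=Q_mF(Q_mx)$$ has a solution $x=x_\alpha^\delta\in X_m^0$ with $$\|x_0-x_\alpha^\delta\|_\sigma\le c\sqrt\delta\qquad\text{and}\qquad\|x_0-x_\alpha^\delta\|\le C\sqrt\delta .$$ -/

import Mathlib

open Set MeasureTheory
open scoped ContDiff

namespace Autoconv

/-- Lebesgue measure on the unit interval `(0,1)`. -/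
noncomputable def unitMeasure : Measure ℝ := volume.restrict (Ioo 0 1)

/-- The autoconvolution operator `[F(x)](s) = ∫₀ˢ x(s-t) x(t) dt`. -/
noncomputable def autoconv (x : ℝ → ℝ) (s : ℝ) : ℝ :=
  ∫ t in (0 : ℝ)..s, x (s - t) * x t

/-- The weighted norm `‖x‖_σ = (∫₀¹ e^{-2σt} x(t)² dt)^{1/2}`. -/
noncomputable def weightedNorm (σ : ℝ) (x : ℝ → ℝ) : ℝ :=
  Real.sqrt (∫ t in (0 : ℝ)..1, Real.exp (-2 * σ * t) * x t ^ 2)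

/-- The norm of `L₂(0,1)`. -/
noncomputable def l2Norm (x : ℝ → ℝ) : ℝ :=
  Real.sqrt (∫ t in (0 : ℝ)..1, x t ^ 2)

/-- `v` is a weak derivative of `u` on `(0,1)`. -/
def HasWeakDeriv (u v : ℝ → ℝ) : Prop :=
  ∀ φ : ℝ → ℝ, ContDiff ℝ ∞ φ → HasCompactSupport φ → tsupport φ ⊆ Ioo 0 1 →
    ∫ s in (0 : ℝ)..1, u s * deriv φ s = -∫ s in (0 : ℝ)..1, v s * φ s

/-- Membership in the Sobolev space `W²_∞(0,1)`. -/
def MemW2Infty (u : ℝ → ℝ) : Prop :=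
  MemLp u ⊤ unitMeasure ∧
    ∃ v w : ℝ → ℝ, MemLp v ⊤ unitMeasure ∧ MemLp w ⊤ unitMeasure ∧
      HasWeakDeriv u v ∧ HasWeakDeriv v w

/-- The assumptions on the exact solution: it is a positive element of `W²_∞(0,1)`, represented by
its continuous representative on `[0,1]`, and it is positive at `0` as well. -/
structure IsAdmissibleSolution (x₀ : ℝ → ℝ) : Prop where
  continuousOn : ContinuousOn x₀ (Icc 0 1)
  pos : ∀ s ∈ Ico (0 : ℝ) 1, 0 < x₀ s
  memW2Infty : MemW2Infty x₀

/-- `yδ` is a measurable function on `(0,1)` with `‖yδ - F(x₀)‖_∞ ≤ δ`. -/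
def IsNoisyData (x₀ yδ : ℝ → ℝ) (δ : ℝ) : Prop :=
  AEStronglyMeasurable yδ unitMeasure ∧ ∀ᵐ s ∂unitMeasure, |yδ s - autoconv x₀ s| ≤ δ

/-- The `i`-th cell `[i/m, (i+1)/m)` of the equidistant partition, `i = 0, …, m-1`. -/
def cell (m i : ℕ) : Set ℝ := Ico ((i : ℝ) / m) (((i : ℝ) + 1) / m)

/-- The space `X_m⁰` of piecewise constant splines on `[0,1)`. -/
def splineSpace (m : ℕ) : Set (ℝ → ℝ) :=
  {x | ∃ a : Fin m → ℝ, ∀ i : Fin m, ∀ s ∈ cell m i, x s = a i}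

/-- The index of the cell that contains `s`; the point `1` is assigned to the last cell. -/
noncomputable def cellIndex (m : ℕ) (s : ℝ) : ℕ := min ⌊(m : ℝ) * s⌋₊ (m - 1)

/-- The mean value of `y` over the `i`-th cell. -/
noncomputable def cellMean (m i : ℕ) (y : ℝ → ℝ) : ℝ :=
  m * ∫ t in ((i : ℝ) / m)..(((i : ℝ) + 1) / m), y t

/-- The `L₂(0,1)`-orthogonal projection `Q_m` onto `X_m⁰`, given by mean values over the cells; see
`splineProj_mem` and `splineProj_orthogonal`. -/
noncomputable def splineProj (m : ℕ) (y : ℝ → ℝ) (s : ℝ) : ℝ := cellMean m (cellIndex m s) y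

theorem cellIndex_eq {m i : ℕ} (hi : i < m) {s : ℝ} (hs : s ∈ cell m i) : cellIndex m s = i := by
  have hm : (0 : ℝ) < m := by exact_mod_cast (Nat.zero_le i).trans_lt hi
  obtain ⟨h1, h2⟩ := hs
  rw [div_le_iff₀ hm] at h1
  rw [lt_div_iff₀ hm] at h2
  have : ⌊(m : ℝ) * s⌋₊ = i := by
    rw [Nat.floor_eq_iff (by nlinarith [Nat.cast_nonneg (α := ℝ) i])]
    constructor <;> linarith
  unfold cellIndex
  omega

/-- `Q_m y` is a piecewise constant spline. -/
theorem splineProj_mem (m : ℕ) (y : ℝ → ℝ) : splineProj m y ∈ splineSpace m :=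
  ⟨fun i => cellMean m i y, fun i s hs => by simp only [splineProj, cellIndex_eq i.2 hs]⟩

/-- `y - Q_m y` is orthogonal in `L₂(0,1)` to every piecewise constant spline. -/
theorem splineProj_orthogonal {m : ℕ} (hm : 0 < m) {y z : ℝ → ℝ}
    (hy : MemLp y 2 unitMeasure) (hz : z ∈ splineSpace m) :
    ∫ t in (0 : ℝ)..1, (y t - splineProj m y t) * z t = 0 := by
  obtain ⟨a, ha⟩ := hz
  have hm0 : (0 : ℝ) < m := by exact_mod_cast hm
  have hfin : IsFiniteMeasure unitMeasure := by unfold unitMeasure; infer_instance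
  have hy1 : IntervalIntegrable y volume 0 1 := by
    rw [intervalIntegrable_iff_integrableOn_Ioo_of_le zero_le_one]
    exact hy.integrable (by norm_num)
  have hle : ∀ i : ℕ, (i : ℝ) / m ≤ ((i : ℝ) + 1) / m := fun i => by gcongr; linarith
  have key : ∀ i : Fin m,
      EqOn (fun t => (y t - splineProj m y t) * z t) (fun t => (y t - cellMean m i y) * a i)
        (Ioo ((i : ℝ) / m) (((i : ℝ) + 1) / m)) := by
    intro i t ht
    have ht' : t ∈ cell m i := ⟨ht.1.le, ht.2⟩
    simp only [splineProj, cellIndex_eq i.2 ht', ha i t ht']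
  have hyi : ∀ i : Fin m, IntervalIntegrable y volume ((i : ℝ) / m) (((i : ℝ) + 1) / m) := by
    intro i
    refine hy1.mono_set ?_
    rw [uIcc_of_le (hle i), uIcc_of_le zero_le_one]
    refine Icc_subset_Icc (by positivity) ?_
    rw [div_le_one hm0]
    exact_mod_cast i.2
  have hint : ∀ i : Fin m, IntervalIntegrable (fun t => (y t - splineProj m y t) * z t) volume
      ((i : ℝ) / m) (((i : ℝ) + 1) / m) := by
    intro i
    have h : IntervalIntegrable (fun t => (y t - cellMean m i y) * a i) volume
        ((i : ℝ) / m) (((i : ℝ) + 1) / m) :=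
      ((hyi i).sub intervalIntegrable_const).mul_const _
    rw [intervalIntegrable_iff_integrableOn_Ioo_of_le (hle i)] at h ⊢
    exact h.congr_fun (key i).symm measurableSet_Ioo
  have hzero : ∀ i : Fin m,
      ∫ t in ((i : ℝ) / m)..(((i : ℝ) + 1) / m), (y t - splineProj m y t) * z t = 0 := by
    intro i
    have h1 : ∫ t in ((i : ℝ) / m)..(((i : ℝ) + 1) / m), (y t - splineProj m y t) * z t =
        ∫ t in ((i : ℝ) / m)..(((i : ℝ) + 1) / m), (y t - cellMean m i y) * a i := by
      simp only [intervalIntegral.integral_of_le (hle i), integral_Ioc_eq_integral_Ioo]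
      exact setIntegral_congr_fun measurableSet_Ioo (key i)
    rw [h1, intervalIntegral.integral_mul_const,
      intervalIntegral.integral_sub (hyi i) intervalIntegrable_const,
      intervalIntegral.integral_const]
    simp only [cellMean, smul_eq_mul]
    field_simp
    ring
  have hsum := intervalIntegral.sum_integral_adjacent_intervals (μ := volume)
    (f := fun t => (y t - splineProj m y t) * z t) (a := fun k : ℕ => (k : ℝ) / m) (n := m)
    (fun k hk => by simpa using hint ⟨k, hk⟩)
  simp only [Nat.cast_zero, zero_div, div_self hm0.ne'] at hsum
  rw [← hsum]
  refine Finset.sum_eq_zero fun k hk => ?_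
  simpa using hzero ⟨k, Finset.mem_range.1 hk⟩

/-- The value of the constant reference element `x_*`, computed from the data. -/
noncomputable def refValue (m : ℕ) (δ : ℝ) (yδ : ℝ → ℝ) : ℝ :=
  if 0 ≤ splineProj m yδ (Real.sqrt δ) then
    Real.sqrt (1 / Real.sqrt δ * splineProj m yδ (Real.sqrt δ))
  else 0

/-- The discretized Lavrent'ev equation `α Q_m(x_* - x) + Q_m yδ = Q_m F(Q_m x)` on `[0,1]`, with
`x_*` the constant function `xs`. -/
def SolvesDiscreteLavrentiev (m : ℕ) (α xs : ℝ) (yδ x : ℝ → ℝ) : Prop :=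
  ∀ s ∈ Icc (0 : ℝ) 1,
    α * splineProj m (fun t => xs - x t) s + splineProj m yδ s =
      splineProj m (autoconv (splineProj m x)) s

end Autoconv

/-!
Write `x = x₀ + h`. The equation becomes `α h + A h + h * h = α (x_* - x₀) + (errors)`, where
`A h = 2 x₀ * h` and `*` is convolution on `(0,1)`. Only two properties of `x₀` matter: it is
Lipschitz continuous, which follows by testing the weak derivative with primitives of differences of
bumps (`MemW2Infty.exists_lipschitzOnWith`), and `x₀(0) > 0`.

With `J` the integration operator, `A = a J (1 + R)`, where `a = 2 x₀(0)` and `R` is the convolution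
with `x₀' / x₀(0)`. Conjugated with the weight `e^{-σt}`, the operator `J` is accretive, so that
`‖(α + a J)⁻¹‖ ≤ 1 / α`, while `‖R‖` tends to `0` as `σ → ∞`. The approximation error splits into
`x_* - x₀(0)`, which is `O(√δ)` since `[F(x₀)](s) = s x₀(0)² + O(s²)` (`abs_refValue_sub_le`), and
`x₀(0) - x₀ = -J x₀'`, which lies in the range of `J` and therefore contributes only
`O((α / a) ‖x₀'‖_σ)` to `h` (`norm_le_of_accretive`); the weighted norm of `x₀'` is small for large
`σ`. As `‖h * h‖_σ ≤ ‖h‖_σ²`, the equation has a solution with `‖h‖_σ ≤ α / 8` by the contraction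
principle, once `σ` is large and all the other errors, of order `√δ` in `x_*` and of order `δ` in
the data, are small multiples of `α` and `α²` (`exists_solution_of_accretive`). The latter holds for
`α = c √δ` with `c` large.

All this is done for the discrete problem. The cell means of the autoconvolution of a spline are a
Cauchy product averaged with its shift (`cellMean_autoconv_spline`), so the equation is a quadratic
system for the coefficients of the spline. Its solution is compared with the grid values of `x₀`,
and the difference is multiplied by the weights `e^{-σ i / m}`, which makes the Euclidean norm the
relevant one. The quadratures involved have errors of the order `1 / m ≤ δ`
(`exists_discrete_solution`).
-/

namespace Autoconv

/-! ### Lavrent'ev equations whose linear part is a perturbation of an accretive operator -/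

section Abstract

variable {H : Type*} [NormedAddCommGroup H] [InnerProductSpace ℝ H]

/-- Resolvent estimate for an accretive operator. -/
theorem mul_norm_le_norm_smul_add {J : H →ₗ[ℝ] H} (hJ : ∀ g, 0 ≤ inner ℝ (J g) g) {α a : ℝ}
    (ha : 0 ≤ a) (g : H) : α * ‖g‖ ≤ ‖α • g + a • J g‖ := by
  rcases eq_or_ne g 0 with rfl | hg
  · simp
  have h1 : α * ‖g‖ * ‖g‖ ≤ inner ℝ (α • g + a • J g) g := by
    rw [inner_add_left, inner_smul_left, inner_smul_left, real_inner_self_eq_norm_sq]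
    have := mul_nonneg ha (hJ g)
    simp only [conj_trivial]
    nlinarith
  exact le_of_mul_le_mul_right (h1.trans (real_inner_le_norm _ _)) (norm_pos_iff.2 hg)

/-- Stability of `α g + a J (g + R g) + D g` for accretive `J`. A part `-α J d` of the right-hand
side, which has to be a multiple of `α` in the range of `J`, enters only with the factor `α / a`. -/
theorem norm_le_of_accretive {J R D : H →ₗ[ℝ] H} (hJ : ∀ g, 0 ≤ inner ℝ (J g) g)
    {α a : ℝ} (hα : 0 < α) (ha : 0 < a) (hR : ∀ g, ‖R g‖ ≤ ‖g‖ / 8)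
    (hD : ∀ g, ‖D g‖ ≤ α / 8 * ‖g‖) {g d f : H}
    (h : α • g + a • J (g + R g) + D g = f - α • J d) :
    ‖g‖ ≤ 8 / 5 * (2 * (α / a) * ‖d‖ + ‖f‖ / α) := by
  -- The shift by `(α / a) d` turns the part `-α J d` of the right-hand side into `(α² / a) d`.
  set z := g + R g + (α / a) • d with hz
  have h1 : α • z + a • J z = (α ^ 2 / a) • d + f - D g + α • R g := by
    have h2 : a • J z = a • J (g + R g) + α • J d := by
      rw [hz, map_add _ (g + R g), map_smul, smul_add, smul_smul, mul_div_cancel₀ _ ha.ne']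
    have h3 : α • z = α • g + α • R g + (α ^ 2 / a) • d := by
      rw [hz, smul_add, smul_add, smul_smul]; congr 2; ring
    have h4 : a • J (g + R g) = f - α • J d - D g - α • g := by rw [← h]; abel
    rw [h2, h3, h4]; abel
  have h2 := mul_norm_le_norm_smul_add hJ (α := α) ha.le z
  rw [h1] at h2
  have h3 : ‖(α ^ 2 / a) • d + f - D g + α • R g‖ ≤
      α ^ 2 / a * ‖d‖ + ‖f‖ + α / 8 * ‖g‖ + α * (‖g‖ / 8) := by
    refine (norm_add_le _ _).trans (add_le_add ((norm_sub_le _ _).trans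
      (add_le_add ((norm_add_le _ _).trans (add_le_add_left ?_ _)) (hD g))) ?_)
    · rw [norm_smul, Real.norm_of_nonneg (by positivity)]
    · rw [norm_smul, Real.norm_of_nonneg hα.le]
      exact mul_le_mul_of_nonneg_left (hR g) hα.le
  have h4 : ‖g‖ ≤ ‖z‖ + ‖g‖ / 8 + α / a * ‖d‖ := by
    have : g = z - R g - (α / a) • d := by rw [hz]; abel
    calc ‖g‖ = ‖z - R g - (α / a) • d‖ := by rw [← this]
      _ ≤ ‖z‖ + ‖R g‖ + ‖(α / a) • d‖ :=
        (norm_sub_le _ _).trans (add_le_add_left (norm_sub_le _ _) _)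
      _ ≤ _ := by
        rw [norm_smul, Real.norm_of_nonneg (by positivity)]
        gcongr
        exact hR g
  have h5 : ‖z‖ ≤ α / a * ‖d‖ + ‖f‖ / α + ‖g‖ / 4 := by
    refine le_of_mul_le_mul_left ((h2.trans h3).trans (le_of_eq ?_)) hα
    field_simp
    ring
  linarith

/-- Solvability, with a bound on the solution, of an accretive equation with a quadratic
perturbation, by the contraction principle on a ball of radius proportional to `α`. -/
theorem exists_solution_of_accretive [FiniteDimensional ℝ H] {J R D : H →ₗ[ℝ] H}
    (hJ : ∀ g, 0 ≤ inner ℝ (J g) g) {α a β : ℝ} (hα : 0 < α) (ha : 0 < a) (hβ : 0 < β)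
    (hR : ∀ g, ‖R g‖ ≤ ‖g‖ / 8) (hD : ∀ g, ‖D g‖ ≤ α / 8 * ‖g‖) {q : H → H} (hq0 : q 0 = 0)
    (hq : ∀ g g', β * ‖q g - q g'‖ ≤ (‖g‖ + ‖g'‖) * ‖g - g'‖) {d f : H}
    (hd : ‖d‖ ≤ β * a / 64) (hf : ‖f‖ ≤ β * α ^ 2 / 32) :
    ∃ g, ‖g‖ ≤ β * α / 8 ∧ α • g + a • J (g + R g) + D g + q g = f - α • J d := by
  have : CompleteSpace H := FiniteDimensional.complete ℝ H
  set T : H →ₗ[ℝ] H := α • LinearMap.id + a • (J ∘ₗ (LinearMap.id + R)) + D with hT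
  have hTg : ∀ g, T g = α • g + a • J (g + R g) + D g := fun g => by simp [hT]
  have hinj : Function.Injective T := by
    rw [← LinearMap.ker_eq_bot, LinearMap.ker_eq_bot']
    intro g hg
    have := norm_le_of_accretive hJ hα ha hR hD (g := g) (d := 0) (f := 0)
      (by rw [← hTg, hg]; simp)
    simpa using this
  have hsurj := LinearMap.injective_iff_surjective.1 hinj
  choose S hS using hsurj
  -- `Φ g` solves the linear equation whose right-hand side contains the quadratic term at `g`.
  set Φ : H → H := fun g => S (f - α • J d - q g) with hΦ
  have hΦe : ∀ g, α • Φ g + a • J (Φ g + R (Φ g)) + D (Φ g) = f - α • J d - q g := fun g => by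
    rw [← hTg]; exact hS _
  have hmaps : MapsTo Φ (Metric.closedBall 0 (β * α / 8)) (Metric.closedBall 0 (β * α / 8)) := by
    intro g hg
    rw [mem_closedBall_zero_iff] at hg ⊢
    have h1 := norm_le_of_accretive hJ hα ha hR hD (g := Φ g) (d := d) (f := f - q g)
      (by rw [hΦe]; abel)
    have h2 : ‖q g‖ ≤ β * α ^ 2 / 64 := by
      have h3 := hq g 0
      rw [hq0] at h3
      simp only [norm_zero, sub_zero, add_zero] at h3
      have h4 : ‖g‖ * ‖g‖ ≤ (β * α / 8) * (β * α / 8) := by gcongr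
      refine le_of_mul_le_mul_left (h3.trans (h4.trans (le_of_eq ?_))) hβ
      ring
    have h3 : ‖f - q g‖ / α ≤ β * α * (3 / 64) := by
      rw [div_le_iff₀ hα]
      linarith [norm_sub_le f (q g)]
    have h4 : 2 * (α / a) * ‖d‖ ≤ β * α / 32 := by
      calc 2 * (α / a) * ‖d‖ ≤ 2 * (α / a) * (β * a / 64) := by gcongr
        _ = _ := by field_simp; norm_num
    linarith
  have hcontr : ∀ g ∈ Metric.closedBall (0 : H) (β * α / 8),
      ∀ g' ∈ Metric.closedBall (0 : H) (β * α / 8), ‖Φ g - Φ g'‖ ≤ 2 / 5 * ‖g - g'‖ := by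
    intro g hg g' hg'
    rw [mem_closedBall_zero_iff] at hg hg'
    have h1 := norm_le_of_accretive hJ hα ha hR hD (g := Φ g - Φ g') (d := 0) (f := q g' - q g)
      (by rw [← hTg, map_sub, hTg, hTg, hΦe, hΦe]; simp)
    have h2 : ‖q g' - q g‖ ≤ α / 4 * ‖g - g'‖ := by
      rw [norm_sub_rev]
      refine le_of_mul_le_mul_left ((hq g g').trans ?_) hβ
      calc (‖g‖ + ‖g'‖) * ‖g - g'‖ ≤ (β * α / 8 + β * α / 8) * ‖g - g'‖ := by gcongr
        _ = _ := by ring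
    have h3 : ‖q g' - q g‖ / α ≤ ‖g - g'‖ / 4 := by
      rw [div_le_iff₀ hα]; linarith
    simp only [norm_zero, mul_zero, zero_add] at h1
    linarith
  have hc : ContractingWith (2 / 5) (hmaps.restrict Φ _ _) := by
    refine ⟨by rw [div_lt_one] <;> norm_num, LipschitzWith.of_dist_le_mul fun g g' => ?_⟩
    have := hcontr g g.2 g' g'.2
    rw [Subtype.dist_eq, Subtype.dist_eq, dist_eq_norm, dist_eq_norm]
    simpa using this
  obtain ⟨g, hg, hfix, -⟩ := hc.exists_fixedPoint' Metric.isClosed_closedBall.isComplete hmaps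
    (Metric.mem_closedBall_self (by positivity)) (edist_ne_top 0 _)
  refine ⟨g, mem_closedBall_zero_iff.1 hg, ?_⟩
  have := hΦe g
  rw [hfix.eq] at this
  rw [this]
  abel

end Abstract

/-! ### Discrete convolution -/

/-- The Cauchy product of two sequences. -/
def cauchyProd (u v : ℕ → ℝ) (i : ℕ) : ℝ :=
  ∑ p ∈ Finset.HasAntidiagonal.antidiagonal i, u p.1 * v p.2

/-- The sequence `u`, delayed by one step. -/
def delay (u : ℕ → ℝ) (i : ℕ) : ℝ := if 1 ≤ i then u (i - 1) else 0

theorem cauchyProd_eq_coeff (u v : ℕ → ℝ) (i : ℕ) :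
    cauchyProd u v i = PowerSeries.coeff i (PowerSeries.mk u * PowerSeries.mk v) := by
  simp [cauchyProd, PowerSeries.coeff_mul]

theorem cauchyProd_comm (u v : ℕ → ℝ) : cauchyProd u v = cauchyProd v u := by
  ext i
  rw [cauchyProd_eq_coeff, cauchyProd_eq_coeff, mul_comm]

theorem mk_cauchyProd (u v : ℕ → ℝ) :
    PowerSeries.mk (cauchyProd u v) = PowerSeries.mk u * PowerSeries.mk v := by
  ext i
  rw [PowerSeries.coeff_mk, cauchyProd_eq_coeff]

theorem cauchyProd_assoc (u v w : ℕ → ℝ) :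
    cauchyProd (cauchyProd u v) w = cauchyProd u (cauchyProd v w) := by
  ext i
  rw [cauchyProd_eq_coeff, cauchyProd_eq_coeff, mk_cauchyProd, mk_cauchyProd, mul_assoc]

theorem cauchyProd_add (u v w : ℕ → ℝ) (i : ℕ) :
    cauchyProd u (fun j => v j + w j) i = cauchyProd u v i + cauchyProd u w i := by
  simp [cauchyProd, mul_add, Finset.sum_add_distrib]

theorem add_cauchyProd (u v w : ℕ → ℝ) (i : ℕ) :
    cauchyProd (fun j => u j + v j) w i = cauchyProd u w i + cauchyProd v w i := by
  simp [cauchyProd, add_mul, Finset.sum_add_distrib]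

theorem cauchyProd_mul (c : ℝ) (u v : ℕ → ℝ) (i : ℕ) :
    cauchyProd u (fun j => c * v j) i = c * cauchyProd u v i := by
  simp [cauchyProd, mul_left_comm _ c, Finset.mul_sum]

theorem mul_cauchyProd (c : ℝ) (u v : ℕ → ℝ) (i : ℕ) :
    cauchyProd (fun j => c * u j) v i = c * cauchyProd u v i := by
  simp [cauchyProd, mul_assoc, Finset.mul_sum]

theorem cauchyProd_congr {u u' v v' : ℕ → ℝ} {i : ℕ} (hu : ∀ j ≤ i, u j = u' j)
    (hv : ∀ j ≤ i, v j = v' j) : cauchyProd u v i = cauchyProd u' v' i := by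
  refine Finset.sum_congr rfl fun p hp => ?_
  rw [Finset.HasAntidiagonal.mem_antidiagonal] at hp
  rw [hu _ (by omega), hv _ (by omega)]

theorem cauchyProd_pow_mul (ρ : ℝ) (u v : ℕ → ℝ) (i : ℕ) :
    cauchyProd (fun j => ρ ^ j * u j) (fun j => ρ ^ j * v j) i = ρ ^ i * cauchyProd u v i := by
  rw [cauchyProd, cauchyProd, Finset.mul_sum]
  refine Finset.sum_congr rfl fun p hp => ?_
  rw [Finset.HasAntidiagonal.mem_antidiagonal] at hp
  rw [← hp, pow_add]
  ring

theorem cauchyProd_delay (u v : ℕ → ℝ) (i : ℕ) :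
    cauchyProd (delay u) v i = delay (cauchyProd u v) i := by
  rcases i with _ | i
  · simp [cauchyProd, delay]
  · rw [cauchyProd, Finset.Nat.sum_antidiagonal_succ]
    simp [cauchyProd, delay]

variable {m : ℕ}

/-- A vector with `m` entries as a sequence that vanishes from the index `m` on. -/
def extendZero (g : EuclideanSpace ℝ (Fin m)) (i : ℕ) : ℝ := if h : i < m then g ⟨i, h⟩ else 0

@[simp]
theorem extendZero_coe (g : EuclideanSpace ℝ (Fin m)) (i : Fin m) : extendZero g i = g i := by
  simp [extendZero]

@[simp]
theorem extendZero_zero (i : ℕ) : extendZero (0 : EuclideanSpace ℝ (Fin m)) i = 0 := by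
  simp [extendZero]

theorem extendZero_toLp (u : ℕ → ℝ) {i : ℕ} (hi : i < m) :
    extendZero (WithLp.toLp 2 fun i : Fin m => u i) i = u i := by
  simp [extendZero, hi]

theorem extendZero_add (g g' : EuclideanSpace ℝ (Fin m)) (i : ℕ) :
    extendZero (g + g') i = extendZero g i + extendZero g' i := by
  unfold extendZero; split <;> simp

theorem extendZero_sub (g g' : EuclideanSpace ℝ (Fin m)) (i : ℕ) :
    extendZero (g - g') i = extendZero g i - extendZero g' i := by
  unfold extendZero; split <;> simp

theorem extendZero_smul (c : ℝ) (g : EuclideanSpace ℝ (Fin m)) (i : ℕ) :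
    extendZero (c • g) i = c * extendZero g i := by
  unfold extendZero; split <;> simp

theorem norm_sq_eq_sum_extendZero (g : EuclideanSpace ℝ (Fin m)) :
    ‖g‖ ^ 2 = ∑ i ∈ Finset.range m, extendZero g i ^ 2 := by
  rw [EuclideanSpace.norm_sq_eq, Finset.sum_range]
  simp

theorem norm_le_sqrt_mul {g : EuclideanSpace ℝ (Fin m)} {b : ℝ} (hb : 0 ≤ b)
    (h : ∀ i < m, |extendZero g i| ≤ b) : ‖g‖ ≤ √m * b := by
  refine abs_le_of_sq_le_sq' ?_ (by positivity) |>.2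
  rw [norm_sq_eq_sum_extendZero, mul_pow, Real.sq_sqrt (Nat.cast_nonneg m)]
  calc ∑ i ∈ Finset.range m, extendZero g i ^ 2 ≤ ∑ _i ∈ Finset.range m, b ^ 2 :=
        Finset.sum_le_sum fun i hi => sq_le_sq' (abs_le.1 (h i (Finset.mem_range.1 hi))).1
          (abs_le.1 (h i (Finset.mem_range.1 hi))).2
    _ = _ := by simp

theorem sum_abs_extendZero_le (g : EuclideanSpace ℝ (Fin m)) :
    ∑ i ∈ Finset.range m, |extendZero g i| ≤ √m * ‖g‖ := by
  refine abs_le_of_sq_le_sq' ?_ (by positivity) |>.2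
  rw [mul_pow, Real.sq_sqrt (Nat.cast_nonneg m), norm_sq_eq_sum_extendZero]
  simpa using sq_sum_le_card_mul_sum_sq (s := Finset.range m) (f := fun i => |extendZero g i|)

/-- The truncated shift by `j` entries. -/
def shift (j : ℕ) (g : EuclideanSpace ℝ (Fin m)) : EuclideanSpace ℝ (Fin m) :=
  WithLp.toLp 2 fun i : Fin m => if j ≤ (i : ℕ) then extendZero g (i - j) else 0

theorem norm_shift_le (j : ℕ) (g : EuclideanSpace ℝ (Fin m)) : ‖shift j g‖ ≤ ‖g‖ := by
  refine abs_le_of_sq_le_sq' ?_ (norm_nonneg _) |>.2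
  rw [norm_sq_eq_sum_extendZero, norm_sq_eq_sum_extendZero]
  have h1 : ∀ i ∈ Finset.range m, extendZero (shift j g) i ^ 2 =
      (if j ≤ i then extendZero g (i - j) else 0) ^ 2 := fun i hi => by
    rw [shift, extendZero_toLp (fun i => if j ≤ i then extendZero g (i - j) else 0)
      (Finset.mem_range.1 hi)]
  rw [Finset.sum_congr rfl h1]
  calc ∑ i ∈ Finset.range m, (if j ≤ i then extendZero g (i - j) else 0) ^ 2
      ≤ ∑ i ∈ Finset.range (j + m), (if j ≤ i then extendZero g (i - j) else 0) ^ 2 :=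
        Finset.sum_le_sum_of_subset_of_nonneg (Finset.range_mono (by omega))
          fun _ _ _ => sq_nonneg _
    _ = _ := by
      rw [Finset.sum_range_add, Finset.sum_eq_zero, zero_add]
      · simp
      · intro i hi
        have := Finset.mem_range.1 hi
        rw [if_neg (by omega)]
        norm_num

theorem shift_sub (j : ℕ) (g g' : EuclideanSpace ℝ (Fin m)) :
    shift j g - shift j g' = shift j (g - g') := by
  ext i
  simp only [shift, PiLp.sub_apply, extendZero_sub]
  split <;> simp

/-- Discrete convolution with the kernel `u` on a grid of step size `1 / m`. -/
noncomputable def convOp (m : ℕ) (u : ℕ → ℝ) :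
    EuclideanSpace ℝ (Fin m) →ₗ[ℝ] EuclideanSpace ℝ (Fin m) where
  toFun g := WithLp.toLp 2 fun i : Fin m => cauchyProd u (extendZero g) i / m
  map_add' g g' := by
    ext i
    have : extendZero (g + g') = fun j => extendZero g j + extendZero g' j :=
      funext (extendZero_add g g')
    simp [this, cauchyProd_add, add_div]
  map_smul' c g := by
    ext i
    have : extendZero (c • g) = fun j => c * extendZero g j := funext (extendZero_smul c g)
    simp [this, cauchyProd_mul, mul_div_assoc]

theorem extendZero_convOp (u : ℕ → ℝ) (g : EuclideanSpace ℝ (Fin m)) {i : ℕ} (hi : i < m) :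
    extendZero (convOp m u g) i = cauchyProd u (extendZero g) i / m :=
  extendZero_toLp (fun i => cauchyProd u (extendZero g) i / m) hi

theorem convOp_eq_sum_shift (u : ℕ → ℝ) (g : EuclideanSpace ℝ (Fin m)) :
    convOp m u g = (1 / m : ℝ) • ∑ j ∈ Finset.range m, u j • shift j g := by
  ext i
  rw [← extendZero_coe, extendZero_convOp _ _ i.2, PiLp.smul_apply, WithLp.ofLp_sum,
    Finset.sum_apply, cauchyProd, Finset.Nat.sum_antidiagonal_eq_sum_range_succ_mk, smul_eq_mul,
    one_div_mul_eq_div]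
  congr 1
  refine Finset.sum_subset_zero_on_sdiff (Finset.range_mono i.2) (fun j hj => ?_) fun j hj => ?_
  · rw [Finset.mem_sdiff, Finset.mem_range, Finset.mem_range] at hj
    simp [shift, show ¬ j ≤ (i : ℕ) by omega]
  · rw [Finset.mem_range] at hj
    simp [shift, show j ≤ (i : ℕ) by omega]

/-- Young's inequality for discrete convolution. -/
theorem norm_convOp_le (u : ℕ → ℝ) (g : EuclideanSpace ℝ (Fin m)) :
    ‖convOp m u g‖ ≤ (∑ j ∈ Finset.range m, |u j|) / m * ‖g‖ := by
  rw [convOp_eq_sum_shift, norm_smul, Real.norm_of_nonneg (by positivity), one_div_mul_eq_div,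
    div_mul_eq_mul_div]
  gcongr
  rw [Finset.sum_mul]
  refine (norm_sum_le _ _).trans (Finset.sum_le_sum fun j _ => ?_)
  rw [norm_smul, Real.norm_eq_abs]
  exact mul_le_mul_of_nonneg_left (norm_shift_le j g) (abs_nonneg _)

/-- Integration, conjugated with an exponential weight, is accretive. -/
theorem inner_convOp_pow_nonneg {ρ : ℝ} (h0 : 0 ≤ ρ) (h1 : ρ ≤ 1)
    (g : EuclideanSpace ℝ (Fin m)) : 0 ≤ inner ℝ (convOp m (fun j => ρ ^ j) g) g := by
  set s := cauchyProd (fun j => ρ ^ j) (extendZero g) with hs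
  have hsucc : ∀ i, s (i + 1) = extendZero g (i + 1) + ρ * s i := fun i => by
    rw [hs, cauchyProd, Finset.Nat.sum_antidiagonal_succ, cauchyProd, Finset.mul_sum]
    simp [pow_succ', mul_assoc]
  have hzero : s 0 = extendZero g 0 := by simp [hs, cauchyProd]
  -- Since `g i = s i - ρ s (i - 1)`, twice the product `s i * g i` dominates `s i² - s (i - 1)²`.
  have key : ∀ n, s n ^ 2 ≤ 2 * ∑ i ∈ Finset.range (n + 1), s i * extendZero g i := by
    intro n
    induction n with
    | zero => simp [hzero]; nlinarith [sq_nonneg (extendZero g 0)]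
    | succ n ih =>
      rw [Finset.sum_range_succ, mul_add]
      have h2 : extendZero g (n + 1) = s (n + 1) - ρ * s n := by rw [hsucc]; ring
      have h3 : ρ ^ 2 * s n ^ 2 ≤ s n ^ 2 :=
        mul_le_of_le_one_left (sq_nonneg _) (pow_le_one₀ h0 h1)
      rw [h2]
      nlinarith [sq_nonneg (s (n + 1) - ρ * s n)]
  have hpos : ∀ n, 0 ≤ ∑ i ∈ Finset.range n, s i * extendZero g i := by
    rintro (_ | n)
    · simp
    · nlinarith [key n, sq_nonneg (s n)]
  have : inner ℝ (convOp m (fun j => ρ ^ j) g) g =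
      (∑ i ∈ Finset.range m, s i * extendZero g i) / m := by
    rw [Finset.sum_range, Finset.sum_div, PiLp.inner_apply]
    refine Finset.sum_congr rfl fun i _ => ?_
    rw [← extendZero_coe, extendZero_convOp _ _ i.2, ← extendZero_coe]
    simp only [← hs, RCLike.inner_apply, conj_trivial]
    ring
  rw [this]
  exact div_nonneg (hpos m) (Nat.cast_nonneg m)

/-- A bound for a geometric series without its first term. The first term is left out since it would
not be small for a ratio `x = e^{-t}` with large `t`. -/
theorem mul_sum_pow_succ_le {x t : ℝ} (hx : 0 ≤ x) (h : t * x ≤ 1 - x) (n : ℕ) :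
    t * ∑ j ∈ Finset.range n, x ^ (j + 1) ≤ 1 := by
  have h1 : (∑ j ∈ Finset.range n, x ^ j) * (1 - x) = 1 - x ^ n := by
    have := geom_sum_mul x n; linarith
  have h2 : 0 ≤ ∑ j ∈ Finset.range n, x ^ j := Finset.sum_nonneg fun _ _ => by positivity
  calc t * ∑ j ∈ Finset.range n, x ^ (j + 1) = (∑ j ∈ Finset.range n, x ^ j) * (t * x) := by
        simp only [pow_succ, ← Finset.sum_mul]; ring
    _ ≤ (∑ j ∈ Finset.range n, x ^ j) * (1 - x) := by gcongr
    _ ≤ 1 := by rw [h1]; linarith [pow_nonneg hx n]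

/-! ### The discrete equation -/

/-- The mean value over the `i`-th cell of the autoconvolution of the spline with coefficients
`a`, see `cellMean_autoconv_spline`. -/
noncomputable def splineAutoconv (m : ℕ) (a : ℕ → ℝ) (i : ℕ) : ℝ :=
  (cauchyProd a a i + delay (cauchyProd a a) i) / (2 * m)

/-- The difference quotients of `p`, with the entry `0` at the index `0`, multiplied by the weights
`ρ ^ j`. -/
noncomputable def weightedDiff (m : ℕ) (ρ : ℝ) (p : ℕ → ℝ) (j : ℕ) : ℝ :=
  ρ ^ j * (m * (p j - p (j - 1)))

/-- `p` is the sum of `p 0` and of the discrete integral of its difference quotients. -/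
theorem cauchyProd_pow_weightedDiff (ρ : ℝ) (p : ℕ → ℝ) (i : ℕ) :
    cauchyProd (fun j => ρ ^ j) (weightedDiff m ρ p) i = ρ ^ i * (m * (p i - p 0)) := by
  have h := cauchyProd_pow_mul ρ (fun j => m * (p j - p (j - 1))) (fun _ => 1) i
  simp only [mul_one] at h
  rw [cauchyProd_comm, show weightedDiff m ρ p = fun j => ρ ^ j * (m * (p j - p (j - 1))) from rfl,
    h]
  congr 1
  rw [cauchyProd, Finset.Nat.sum_antidiagonal_eq_sum_range_succ_mk, Finset.sum_range_succ']
  simp only [mul_one, ← Finset.mul_sum, Nat.add_sub_cancel, Finset.sum_range_sub]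
  simp

/-- The quadratic part of the weighted discrete equation. -/
noncomputable def quadPart (m : ℕ) (ρ : ℝ) (g : EuclideanSpace ℝ (Fin m)) :
    EuclideanSpace ℝ (Fin m) :=
  (1 / 2 : ℝ) • (convOp m (extendZero g) g + ρ • shift 1 (convOp m (extendZero g) g))

theorem extendZero_quadPart (ρ : ℝ) (g : EuclideanSpace ℝ (Fin m)) {i : ℕ} (hi : i < m) :
    extendZero (quadPart m ρ g) i = (cauchyProd (extendZero g) (extendZero g) i +
      ρ * delay (cauchyProd (extendZero g) (extendZero g)) i) / (2 * m) := by
  have h1 : extendZero (shift 1 (convOp m (extendZero g) g)) i =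
      delay (cauchyProd (extendZero g) (extendZero g)) i / m := by
    rw [shift, extendZero_toLp
      (fun i => if 1 ≤ i then extendZero (convOp m (extendZero g) g) (i - 1) else 0) hi, delay]
    split
    · rw [extendZero_convOp _ _ (by omega)]
    · simp
  rw [quadPart, extendZero_smul, extendZero_add, extendZero_smul, h1, extendZero_convOp _ _ hi]
  ring

/-- The local Lipschitz estimate for the quadratic part, by Young's inequality for the product of
`g - g'` and `g + g'`. -/
theorem norm_quadPart_sub_le (hm : 0 < m) {ρ : ℝ} (h0 : 0 ≤ ρ) (h1 : ρ ≤ 1)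
    (g g' : EuclideanSpace ℝ (Fin m)) :
    √m * ‖quadPart m ρ g - quadPart m ρ g'‖ ≤ (‖g‖ + ‖g'‖) * ‖g - g'‖ := by
  set z := convOp m (extendZero (g - g')) (g + g') with hz
  have hdiff : convOp m (extendZero g) g - convOp m (extendZero g') g' = z := by
    ext i
    rw [← extendZero_coe, ← extendZero_coe, extendZero_sub, hz, extendZero_convOp _ _ i.2,
      extendZero_convOp _ _ i.2, extendZero_convOp _ _ i.2,
      show extendZero (g - g') = fun j => extendZero g j + (-1) * extendZero g' j from
        funext fun j => by rw [extendZero_sub]; ring,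
      show extendZero (g + g') = fun j => extendZero g j + extendZero g' j from
        funext (extendZero_add g g'), cauchyProd_add, add_cauchyProd, add_cauchyProd,
      mul_cauchyProd, mul_cauchyProd, cauchyProd_comm (extendZero g') (extendZero g)]
    ring
  have hq : quadPart m ρ g - quadPart m ρ g' = (1 / 2 : ℝ) • (z + ρ • shift 1 z) := by
    rw [quadPart, quadPart, ← hdiff, ← shift_sub]
    module
  have hzn : √m * ‖z‖ ≤ (‖g‖ + ‖g'‖) * ‖g - g'‖ := by
    have h2 : (0 : ℝ) < m := by exact_mod_cast hm
    calc √m * ‖z‖ ≤ √m * ((√m * ‖g - g'‖) / m * ‖g + g'‖) := by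
          gcongr
          refine (norm_convOp_le _ _).trans ?_
          gcongr
          exact sum_abs_extendZero_le _
      _ = (√m * √m) / m * (‖g + g'‖ * ‖g - g'‖) := by ring
      _ = ‖g + g'‖ * ‖g - g'‖ := by rw [Real.mul_self_sqrt h2.le, div_self h2.ne', one_mul]
      _ ≤ _ := by gcongr; exact norm_add_le _ _
  refine le_trans ?_ hzn
  gcongr
  rw [hq, norm_smul, Real.norm_of_nonneg (by norm_num)]
  have h2 : ‖z + ρ • shift 1 z‖ ≤ ‖z‖ + 1 * ‖z‖ := by
    refine (norm_add_le _ _).trans ?_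
    rw [norm_smul, Real.norm_of_nonneg h0]
    gcongr
    exact norm_shift_le 1 z
  linarith

section Weights

variable {σ L : ℝ} {p : ℕ → ℝ}

theorem abs_weightedDiff_le (hm : 0 < m) {ρ : ℝ} (h0 : 0 ≤ ρ)
    (hp : ∀ j, |p (j + 1) - p j| ≤ L / m) (j : ℕ) :
    |weightedDiff m ρ p (j + 1)| ≤ L * ρ ^ (j + 1) := by
  have h2 : (0 : ℝ) < m := by exact_mod_cast hm
  rw [weightedDiff, abs_mul, abs_mul, abs_of_nonneg (pow_nonneg h0 _), abs_of_pos h2,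
    Nat.add_sub_cancel, mul_comm]
  gcongr
  have := hp j
  rw [le_div_iff₀ h2] at this
  linarith

theorem mul_exp_neg_le (u : ℝ) : u * Real.exp (-u) ≤ 1 - Real.exp (-u) := by
  have h1 : Real.exp (-u) * Real.exp u = 1 := by rw [← Real.exp_add]; simp
  nlinarith [Real.add_one_le_exp u, Real.exp_pos (-u)]

theorem sum_range_le_sum_succ {f : ℕ → ℝ} (hf : ∀ i, 0 ≤ f i) (n : ℕ) :
    ∑ j ∈ Finset.range n, f j ≤ f 0 + ∑ j ∈ Finset.range n, f (j + 1) := by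
  have h := Finset.sum_range_succ' f n
  have h' := Finset.sum_range_succ f n
  linarith [hf n]

/-- The weighted `L₁` norm of the difference quotients is at most `L / σ`, for every step size. -/
theorem sum_abs_weightedDiff_le (hm : 0 < m) (hσ : 0 < σ) (hL : 0 ≤ L)
    (hp : ∀ j, |p (j + 1) - p j| ≤ L / m) :
    (∑ j ∈ Finset.range m, |weightedDiff m (Real.exp (-(σ / m))) p j|) / m ≤ L / σ := by
  have h2 : (0 : ℝ) < m := by exact_mod_cast hm
  have h3 := mul_sum_pow_succ_le (Real.exp_pos _).le (mul_exp_neg_le (σ / m)) m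
  have h4 := sum_range_le_sum_succ
    (fun j => abs_nonneg (weightedDiff m (Real.exp (-(σ / m))) p j)) m
  have h5 : ∑ j ∈ Finset.range m, |weightedDiff m (Real.exp (-(σ / m))) p (j + 1)| ≤
      L * ∑ j ∈ Finset.range m, Real.exp (-(σ / m)) ^ (j + 1) := by
    rw [Finset.mul_sum]
    exact Finset.sum_le_sum fun j _ => abs_weightedDiff_le hm (Real.exp_pos _).le hp j
  have h6 : weightedDiff m (Real.exp (-(σ / m))) p 0 = 0 := by simp [weightedDiff]
  rw [h6, abs_zero, zero_add] at h4
  rw [div_mul_eq_mul_div, div_le_one h2] at h3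
  rw [div_le_div_iff₀ h2 hσ]
  calc _ ≤ (L * ∑ j ∈ Finset.range m, Real.exp (-(σ / m)) ^ (j + 1)) * σ := by
        gcongr; exact h4.trans h5
    _ = L * (σ * ∑ j ∈ Finset.range m, Real.exp (-(σ / m)) ^ (j + 1)) := by ring
    _ ≤ L * m := by gcongr

/-- The square of the weighted `L₂` norm of the difference quotients is at most `L² / (2σ)`, for
every step size. -/
theorem sum_sq_weightedDiff_le (hm : 0 < m) (hσ : 0 < σ)
    (hp : ∀ j, |p (j + 1) - p j| ≤ L / m) :
    2 * σ * ∑ j ∈ Finset.range m, weightedDiff m (Real.exp (-(σ / m))) p j ^ 2 ≤ L ^ 2 * m := by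
  have h2 : (0 : ℝ) < m := by exact_mod_cast hm
  have h3 := mul_sum_pow_succ_le (Real.exp_pos _).le (mul_exp_neg_le (2 * σ / m)) m
  have h4 := sum_range_le_sum_succ
    (fun j => sq_nonneg (weightedDiff m (Real.exp (-(σ / m))) p j)) m
  have h5 : ∑ j ∈ Finset.range m, weightedDiff m (Real.exp (-(σ / m))) p (j + 1) ^ 2 ≤
      L ^ 2 * ∑ j ∈ Finset.range m, Real.exp (-(2 * σ / m)) ^ (j + 1) := by
    rw [Finset.mul_sum]
    refine Finset.sum_le_sum fun j _ => ?_
    have h6 := abs_weightedDiff_le hm (Real.exp_pos _).le hp (ρ := Real.exp (-(σ / m))) j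
    rw [← sq_abs, show -(2 * σ / m) = 2 * -(σ / m) by ring, two_mul, Real.exp_add, mul_pow,
      ← mul_pow, ← pow_two, ← pow_mul, mul_comm 2, pow_mul, ← mul_pow]
    exact pow_le_pow_left₀ (abs_nonneg _) h6 2
  have h6 : weightedDiff m (Real.exp (-(σ / m))) p 0 = 0 := by simp [weightedDiff]
  rw [h6, zero_pow two_ne_zero, zero_add] at h4
  rw [div_mul_eq_mul_div, div_le_one h2] at h3
  calc _ ≤ 2 * σ * (L ^ 2 * ∑ j ∈ Finset.range m, Real.exp (-(2 * σ / m)) ^ (j + 1)) := by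
        gcongr; exact h4.trans h5
    _ = L ^ 2 * (2 * σ * ∑ j ∈ Finset.range m, Real.exp (-(2 * σ / m)) ^ (j + 1)) := by ring
    _ ≤ L ^ 2 * m := by gcongr

end Weights

/-- The linear part of the discrete equation is an operator `2 p₀ J (1 + R)`, with `J` the
integration and `R` the convolution with the difference quotients of `p / p₀`, up to a convolution
whose kernel is of the order of the step size. -/
theorem linearPart_eq (hm : 0 < m) {ρ : ℝ} {p : ℕ → ℝ} (hp0 : p 0 ≠ 0)
    (g : EuclideanSpace ℝ (Fin m)) {i : ℕ} (hi : i < m) :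
    2 * p 0 * extendZero (convOp m (fun j => ρ ^ j)
        (g + convOp m (fun j => (1 / p 0) * weightedDiff m ρ p j) g)) i +
      extendZero (convOp m (fun j => ρ * delay (fun k => ρ ^ k * p k) j + (-1) * (ρ ^ j * p j)) g) i
    = (cauchyProd (fun j => ρ ^ j * p j) (extendZero g) i +
      ρ * delay (cauchyProd (fun j => ρ ^ j * p j) (extendZero g)) i) / m := by
  have h2 : (m : ℝ) ≠ 0 := by exact_mod_cast hm.ne'
  set W := extendZero g
  rw [extendZero_convOp _ _ hi, extendZero_convOp _ _ hi, add_cauchyProd, mul_cauchyProd,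
    mul_cauchyProd, cauchyProd_delay]
  have h3 : cauchyProd (fun j => ρ ^ j) (extendZero
      (g + convOp m (fun j => (1 / p 0) * weightedDiff m ρ p j) g)) i =
      cauchyProd (fun j => ρ ^ j)
        (fun k => W k + 1 / (p 0 * m) * cauchyProd (weightedDiff m ρ p) W k) i := by
    simp only [W]
    refine cauchyProd_congr (fun _ _ => rfl) fun j hj => ?_
    rw [extendZero_add, extendZero_convOp _ _ (by omega), mul_cauchyProd]
    field_simp
  have h4 : p 0 * cauchyProd (fun j => ρ ^ j) (extendZero
      (g + convOp m (fun j => (1 / p 0) * weightedDiff m ρ p j) g)) i =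
      cauchyProd (fun j => ρ ^ j * p j) W i := by
    rw [h3, cauchyProd_add, cauchyProd_mul, ← cauchyProd_assoc,
      show cauchyProd (fun j => ρ ^ j) (weightedDiff m ρ p) =
        fun i => m * (ρ ^ i * (p i - p 0)) from
        funext fun i => by rw [cauchyProd_pow_weightedDiff]; ring, mul_cauchyProd,
      show (fun j => ρ ^ j * p j) = fun j => p 0 * ρ ^ j + ρ ^ j * (p j - p 0) from
        funext fun j => by ring, add_cauchyProd, mul_cauchyProd]
    field_simp
  rw [mul_assoc, ← mul_div_assoc, h4]
  ring

/-- The discrete Lavrent'ev equation has a solution close to `p`, if the weight parameter `σ` is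
large compared with the difference quotients of `p`, and if `α` dominates the errors in the data and
in the reference value. -/
theorem exists_discrete_solution (hm : 0 < m) {σ α L xs : ℝ} {p y : ℕ → ℝ} (hσ : 0 < σ)
    (hα : 0 < α) (hL : 0 ≤ L) (hp0 : 0 < p 0) (hp : ∀ j, |p (j + 1) - p j| ≤ L / m)
    (hσ1 : 8 * L ≤ σ * p 0) (hσ2 : 512 * L ^ 2 ≤ σ * p 0 ^ 2) (hαm : 8 * (p 0 + L) ≤ α * m)
    (hxs : |xs - p 0| ≤ α / 64) (hy : ∀ i < m, |y i - splineAutoconv m p i| ≤ α ^ 2 / 64) :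
    ∃ a : ℕ → ℝ, (∀ i < m, α * (xs - a i) + y i = splineAutoconv m a i) ∧
      ∑ i ∈ Finset.range m, (Real.exp (-(σ / m)) ^ i * (a i - p i)) ^ 2 ≤ m * (α / 8) ^ 2 := by
  have h2 : (0 : ℝ) < m := by exact_mod_cast hm
  set ρ := Real.exp (-(σ / m)) with hρ
  have hρ0 : 0 < ρ := Real.exp_pos _
  have hρ1 : ρ ≤ 1 := Real.exp_le_one_iff.2 (by have := div_pos hσ h2; linarith)
  have hρp : ∀ j : ℕ, 0 ≤ ρ ^ j ∧ ρ ^ j ≤ 1 := fun j =>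
    ⟨pow_nonneg hρ0.le _, pow_le_one₀ hρ0.le hρ1⟩
  have hR : ∀ g, ‖convOp m (fun j => (1 / p 0) * weightedDiff m ρ p j) g‖ ≤ ‖g‖ / 8 := by
    intro g
    refine (norm_convOp_le _ _).trans ?_
    have h3 := sum_abs_weightedDiff_le hm hσ hL hp
    rw [← hρ] at h3
    have h4 : (∑ j ∈ Finset.range m, |1 / p 0 * weightedDiff m ρ p j|) / m ≤ 1 / 8 := by
      simp only [abs_mul, ← Finset.mul_sum]
      rw [abs_of_pos (by positivity), mul_div_assoc]
      refine (mul_le_mul_of_nonneg_left h3 (by positivity)).trans ?_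
      rw [div_mul_div_comm, div_le_div_iff₀ (by positivity) (by norm_num)]
      linarith
    calc _ ≤ 1 / 8 * ‖g‖ := by gcongr
      _ = _ := by ring
  have hD : ∀ g, ‖convOp m (fun j => ρ * delay (fun k => ρ ^ k * p k) j + (-1) * (ρ ^ j * p j)) g‖
      ≤ α / 8 * ‖g‖ := by
    intro g
    refine (norm_convOp_le _ _).trans (mul_le_mul_of_nonneg_right ?_ (norm_nonneg _))
    rw [div_le_iff₀ h2]
    refine (sum_range_le_sum_succ (fun _ => abs_nonneg _) m).trans ?_
    have h3 : ∀ j ∈ Finset.range m, |ρ * delay (fun k => ρ ^ k * p k) (j + 1) +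
        (-1) * (ρ ^ (j + 1) * p (j + 1))| ≤ L / m := by
      intro j _
      rw [show ρ * delay (fun k => ρ ^ k * p k) (j + 1) + (-1) * (ρ ^ (j + 1) * p (j + 1)) =
        ρ ^ (j + 1) * -(p (j + 1) - p j) by simp [delay]; ring, abs_mul, abs_neg,
        abs_of_nonneg (hρp _).1]
      exact (mul_le_of_le_one_left (abs_nonneg _) (hρp _).2).trans (hp j)
    have h4 := Finset.sum_le_sum h3
    rw [Finset.sum_const, Finset.card_range, nsmul_eq_mul, mul_div_cancel₀ _ h2.ne'] at h4
    have h5 : |ρ * delay (fun k => ρ ^ k * p k) 0 + (-1) * (ρ ^ 0 * p 0)| = p 0 := by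
      simp [delay, abs_of_pos hp0]
    rw [h5]
    linarith
  set dv : EuclideanSpace ℝ (Fin m) := WithLp.toLp 2 fun i : Fin m => weightedDiff m ρ p i with hdv
  set fv : EuclideanSpace ℝ (Fin m) := WithLp.toLp 2 fun i : Fin m =>
    ρ ^ (i : ℕ) * (α * (xs - p 0) + (y i - splineAutoconv m p i)) with hfv
  have hdvi : ∀ i < m, extendZero dv i = weightedDiff m ρ p i := fun i hi => extendZero_toLp _ hi
  have hfvi : ∀ i < m, extendZero fv i =
      ρ ^ i * (α * (xs - p 0) + (y i - splineAutoconv m p i)) := fun i hi =>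
    extendZero_toLp (fun i => ρ ^ i * (α * (xs - p 0) + (y i - splineAutoconv m p i))) hi
  have hd : ‖dv‖ ≤ √m * (2 * p 0) / 64 := by
    refine abs_le_of_sq_le_sq' ?_ (by positivity) |>.2
    rw [norm_sq_eq_sum_extendZero,
      Finset.sum_congr rfl fun i hi => by rw [hdvi i (Finset.mem_range.1 hi)], div_pow, mul_pow,
      Real.sq_sqrt h2.le]
    have h3 := sum_sq_weightedDiff_le hm hσ hp
    rw [← hρ] at h3
    have h4 : 512 * L ^ 2 * m ≤ σ * p 0 ^ 2 * m := by gcongr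
    refine le_of_mul_le_mul_left ?_ hσ
    nlinarith
  have hf : ‖fv‖ ≤ √m * α ^ 2 / 32 := by
    rw [mul_div_assoc]
    refine norm_le_sqrt_mul (by positivity) fun i hi => ?_
    rw [hfvi i hi, abs_mul, abs_of_nonneg (hρp i).1]
    refine (mul_le_of_le_one_left (abs_nonneg _) (hρp i).2).trans ((abs_add_le _ _).trans ?_)
    rw [abs_mul, abs_of_pos hα]
    nlinarith [hy i hi]
  obtain ⟨g, hg, heq⟩ := exists_solution_of_accretive
    (inner_convOp_pow_nonneg (m := m) hρ0.le hρ1) hα (by linarith : 0 < 2 * p 0)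
    (Real.sqrt_pos.2 h2) hR hD (q := quadPart m ρ) (by ext i; simp [quadPart, shift])
    (norm_quadPart_sub_le hm hρ0.le hρ1) hd hf
  have hcancel : ∀ i : ℕ, ρ ^ i * (extendZero g i / ρ ^ i) = extendZero g i := fun i =>
    mul_div_cancel₀ _ (pow_pos hρ0 i).ne'
  -- The vector `g` holds the weighted deviations `ρ ^ i * (a i - p i)`.
  refine ⟨fun i => p i + extendZero g i / ρ ^ i, fun i hi => ?_, ?_⟩
  · have h3 := congrArg (fun v => extendZero v i) heq
    simp only [extendZero_add, extendZero_sub, extendZero_smul, extendZero_quadPart ρ g hi,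
      hfvi i hi] at h3
    have h4 := linearPart_eq hm (ρ := ρ) hp0.ne' g hi
    have h5 : extendZero (convOp m (fun j => ρ ^ j) dv) i = ρ ^ i * (p i - p 0) := by
      rw [extendZero_convOp _ _ hi, cauchyProd_congr (fun _ _ => rfl)
        fun j hj => hdvi j (by omega), cauchyProd_pow_weightedDiff]
      field_simp
    rw [h5] at h3
    set P : ℕ → ℝ := fun j => ρ ^ j * p j with hP
    set W := extendZero g with hW
    set a : ℕ → ℝ := fun i => p i + W i / ρ ^ i with ha
    have h6 : (fun j => ρ ^ j * a j) = fun j => P j + W j := funext fun j => by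
      simp only [ha, hP, mul_add, hcancel]
    -- Binomial expansions of the Cauchy square of `a` and of its delay.
    have h7 : ∀ k, ρ ^ k * cauchyProd a a k =
        ρ ^ k * cauchyProd p p k + 2 * cauchyProd P W k + cauchyProd W W k := fun k => by
      rw [← cauchyProd_pow_mul, ← cauchyProd_pow_mul, h6, cauchyProd_add, add_cauchyProd,
        add_cauchyProd, cauchyProd_comm W P]
      ring
    have h8 : ρ ^ i * delay (cauchyProd a a) i = ρ ^ i * delay (cauchyProd p p) i +
        2 * (ρ * delay (cauchyProd P W) i) + ρ * delay (cauchyProd W W) i := by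
      rcases i with _ | i
      · simp [delay]
      · simp only [delay, Nat.add_sub_cancel, le_add_iff_nonneg_left, zero_le, if_true]
        rw [pow_succ', mul_assoc, h7]
        ring
    have h9 : ρ ^ i * splineAutoconv m a i = ρ ^ i * splineAutoconv m p i +
        (cauchyProd P W i + ρ * delay (cauchyProd P W) i) / m +
        (cauchyProd W W i + ρ * delay (cauchyProd W W) i) / (2 * m) := by
      rw [splineAutoconv, splineAutoconv, ← mul_div_assoc, mul_add, h7, h8]
      field_simp
      ring
    refine mul_left_cancel₀ (pow_pos hρ0 i).ne' ?_
    rw [h9, ← h4]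
    have h10 : ρ ^ i * (α * (xs - a i) + y i) =
        ρ ^ i * (α * (xs - p i) + y i) - α * (ρ ^ i * (W i / ρ ^ i)) := by
      simp only [ha]; ring
    rw [h10, hcancel]
    linear_combination -h3
  · have h3 : ∑ i ∈ Finset.range m, (ρ ^ i * (p i + extendZero g i / ρ ^ i - p i)) ^ 2 =
        ‖g‖ ^ 2 := by
      rw [norm_sq_eq_sum_extendZero]
      refine Finset.sum_congr rfl fun i _ => ?_
      rw [add_sub_cancel_left, hcancel]
    rw [h3]
    calc ‖g‖ ^ 2 ≤ (√m * α / 8) ^ 2 := by gcongr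
      _ = _ := by rw [mul_div_assoc, mul_pow, Real.sq_sqrt h2.le]

/-! ### Autoconvolution of splines -/

/-- The spline with the coefficients `a 0, …, a (m - 1)`. -/
noncomputable def spline (m : ℕ) (a : ℕ → ℝ) (s : ℝ) : ℝ := a (cellIndex m s)

theorem spline_mem (m : ℕ) (a : ℕ → ℝ) : spline m a ∈ splineSpace m :=
  ⟨fun i => a i, fun i s hs => by rw [spline, cellIndex_eq i.2 hs]⟩

theorem cellIndex_lt (hm : 0 < m) (s : ℝ) : cellIndex m s < m := by
  unfold cellIndex; omega

theorem spline_eq_of_mem (a : ℕ → ℝ) {i : ℕ} (hi : i < m) {s : ℝ}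
    (h1 : (i : ℝ) / m ≤ s) (h2 : s < ((i : ℝ) + 1) / m) : spline m a s = a i := by
  rw [spline, cellIndex_eq hi ⟨h1, h2⟩]

theorem cell_le (m i : ℕ) : (i : ℝ) / m ≤ ((i : ℝ) + 1) / m := by gcongr; linarith

theorem cellMean_congr {i : ℕ} {f g : ℝ → ℝ}
    (h : EqOn f g (Ioo ((i : ℝ) / m) (((i : ℝ) + 1) / m))) : cellMean m i f = cellMean m i g := by
  rw [cellMean, cellMean, intervalIntegral.integral_of_le (cell_le m i),
    intervalIntegral.integral_of_le (cell_le m i), integral_Ioc_eq_integral_Ioo,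
    integral_Ioc_eq_integral_Ioo, setIntegral_congr_fun measurableSet_Ioo h]

theorem cellMean_const (hm : 0 < m) (i : ℕ) (c : ℝ) : cellMean m i (fun _ => c) = c := by
  have h2 : (m : ℝ) ≠ 0 := by exact_mod_cast hm.ne'
  rw [cellMean, intervalIntegral.integral_const, smul_eq_mul]
  field_simp
  ring

theorem cellMean_spline (hm : 0 < m) (a : ℕ → ℝ) {i : ℕ} (hi : i < m) :
    cellMean m i (spline m a) = a i := by
  rw [cellMean_congr (g := fun _ => a i) fun s hs => spline_eq_of_mem a hi hs.1.le hs.2,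
    cellMean_const hm]

theorem splineProj_spline (hm : 0 < m) (a : ℕ → ℝ) : splineProj m (spline m a) = spline m a :=
  funext fun s => cellMean_spline hm a (cellIndex_lt hm s)

theorem integrable_and_integral_of_eqOn_const {f : ℝ → ℝ} {b b' c : ℝ} (hb : b ≤ b')
    (h : ∀ t, b < t → t < b' → f t = c) :
    IntervalIntegrable f volume b b' ∧ ∫ t in b..b', f t = (b' - b) * c := by
  have h' : EqOn (fun _ => c) f (Ioo b b') := fun t ht => (h t ht.1 ht.2).symm
  refine ⟨(intervalIntegrable_const (c := c)).congr_uIoo (by rwa [uIoo_of_le hb]), ?_⟩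
  rw [intervalIntegral.integral_of_le hb, integral_Ioc_eq_integral_Ioo,
    ← setIntegral_congr_fun measurableSet_Ioo h', ← integral_Ioc_eq_integral_Ioo,
    ← intervalIntegral.integral_of_le hb, intervalIntegral.integral_const, smul_eq_mul]

/-- On a cell, the autoconvolution of a spline interpolates linearly between its values at the
grid points. -/
theorem autoconv_spline (a : ℕ → ℝ) {i : ℕ} (hi : i < m) {τ : ℝ} (h0 : 0 < τ) (h1 : τ < 1) :
    autoconv (spline m a) (((i : ℝ) + τ) / m) =
      (τ * cauchyProd a a i + (1 - τ) * delay (cauchyProd a a) i) / m := by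
  have hm : (0 : ℝ) < m := by exact_mod_cast (Nat.zero_le i).trans_lt hi
  set s := ((i : ℝ) + τ) / m with hs
  set f := fun t => spline m a (s - t) * spline m a t with hf
  have hsub : ∀ l t : ℝ, s - t = (i - l - (m * t - (l + τ))) / m := fun l t => by
    rw [hs]; field_simp; ring
  have hmt : ∀ t c : ℝ, t < c / m ↔ m * t < c := fun t c => by rw [lt_div_iff₀ hm, mul_comm]
  have hmt' : ∀ t c : ℝ, c / m < t ↔ c < m * t := fun t c => by rw [div_lt_iff₀ hm, mul_comm]
  -- The part of the `l`-th cell on which `s - t` lies in the cell with the index `i - l`.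
  have hA : ∀ l ≤ i, IntervalIntegrable f volume ((l : ℝ) / m) (((l : ℝ) + τ) / m) ∧
      ∫ t in ((l : ℝ) / m)..(((l : ℝ) + τ) / m), f t = τ / m * (a l * a (i - l)) := by
    intro l hl
    have h := integrable_and_integral_of_eqOn_const (f := f) (c := a l * a (i - l))
      (b := (l : ℝ) / m) (b' := ((l : ℝ) + τ) / m) (by gcongr; linarith) ?_
    · refine ⟨h.1, h.2.trans ?_⟩
      field_simp
      ring
    · intro t ht1 ht2
      rw [hmt] at ht2
      have ht3 := (hmt' _ _).1 ht1
      rw [hf]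
      dsimp only
      rw [spline_eq_of_mem a (i := l) (by omega) ht1.le (by rw [hmt]; linarith),
        spline_eq_of_mem a (i := i - l) (by omega), mul_comm]
      · rw [hsub l t, Nat.cast_sub hl]; exact div_le_div_of_nonneg_right (by linarith) hm.le
      · rw [hsub l t, Nat.cast_sub hl]; exact div_lt_div_of_pos_right (by linarith) hm
  -- The part of the `l`-th cell on which `s - t` lies in the cell with the index `i - l - 1`.
  have hB : ∀ l < i, IntervalIntegrable f volume (((l : ℝ) + τ) / m) (((l : ℝ) + 1) / m) ∧
      ∫ t in (((l : ℝ) + τ) / m)..(((l : ℝ) + 1) / m), f t =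
        (1 - τ) / m * (a l * a (i - 1 - l)) := by
    intro l hl
    have h := integrable_and_integral_of_eqOn_const (f := f) (c := a l * a (i - 1 - l))
      (b := ((l : ℝ) + τ) / m) (b' := ((l : ℝ) + 1) / m) (by gcongr) ?_
    · refine ⟨h.1, h.2.trans ?_⟩
      field_simp
      ring
    · intro t ht1 ht2
      have ht3 := (hmt' _ _).1 ht1
      have ht4 := (hmt _ _).1 ht2
      have hc : ((i - 1 - l : ℕ) : ℝ) = i - l - 1 := by
        rw [show i - 1 - l = i - (l + 1) by omega, Nat.cast_sub (by omega)]; push_cast; ring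
      rw [hf]
      dsimp only
      rw [spline_eq_of_mem a (i := l) (by omega) ((hmt' _ _).2 (by linarith)).le ht2,
        spline_eq_of_mem a (i := i - 1 - l) (by omega), mul_comm]
      · rw [hsub l t, hc]; exact div_le_div_of_nonneg_right (by linarith) hm.le
      · rw [hsub l t, hc]; exact div_lt_div_of_pos_right (by linarith) hm
  have hAB : ∀ l < i, IntervalIntegrable f volume ((l : ℝ) / m) (((l : ℝ) + 1) / m) ∧
      ∫ t in ((l : ℝ) / m)..(((l : ℝ) + 1) / m), f t =
        τ / m * (a l * a (i - l)) + (1 - τ) / m * (a l * a (i - 1 - l)) := by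
    intro l hl
    refine ⟨(hA l hl.le).1.trans (hB l hl).1, ?_⟩
    rw [← intervalIntegral.integral_add_adjacent_intervals (hA l hl.le).1 (hB l hl).1,
      (hA l hl.le).2, (hB l hl).2]
  have hint : ∀ l < i, IntervalIntegrable f volume ((fun k : ℕ => (k : ℝ) / m) l)
      ((fun k : ℕ => (k : ℝ) / m) (l + 1)) := fun l hl => by simpa using (hAB l hl).1
  have hsum := intervalIntegral.sum_integral_adjacent_intervals hint
  have hint' := IntervalIntegrable.trans_iterate hint
  have h3 : autoconv (spline m a) s = (∑ l ∈ Finset.range i, (τ / m * (a l * a (i - l)) +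
      (1 - τ) / m * (a l * a (i - 1 - l)))) + τ / m * (a i * a (i - i)) := by
    rw [autoconv, ← (hA i le_rfl).2, ← intervalIntegral.integral_add_adjacent_intervals
      (b := (i : ℝ) / m) (by simpa using hint') (hA i le_rfl).1]
    congr 1
    simp only [Nat.cast_zero, zero_div] at hsum
    rw [← hf, ← hsum]
    refine Finset.sum_congr rfl fun l hl => ?_
    simpa using (hAB l (Finset.mem_range.1 hl)).2
  have h4 : cauchyProd a a i =
      (∑ l ∈ Finset.range i, a l * a (i - l)) + a i * a (i - i) := by
    rw [cauchyProd, Finset.Nat.sum_antidiagonal_eq_sum_range_succ_mk, Finset.sum_range_succ]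
  have h5 : delay (cauchyProd a a) i = ∑ l ∈ Finset.range i, a l * a (i - 1 - l) := by
    rcases i with _ | i
    · simp [delay]
    · simp [delay, cauchyProd, Finset.Nat.sum_antidiagonal_eq_sum_range_succ_mk]
  rw [h3, h4, h5, Finset.sum_add_distrib, ← Finset.mul_sum, ← Finset.mul_sum]
  ring

theorem autoconv_spline_eqOn (a : ℕ → ℝ) {i : ℕ} (hi : i < m) :
    EqOn (autoconv (spline m a)) (fun s => ((m * s - i) * cauchyProd a a i +
      (1 - (m * s - i)) * delay (cauchyProd a a) i) / m)
      (Ioo ((i : ℝ) / m) (((i : ℝ) + 1) / m)) := by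
  have hm : (0 : ℝ) < m := by exact_mod_cast (Nat.zero_le i).trans_lt hi
  intro s hs
  have h1 := hs.1
  have h2 := hs.2
  rw [div_lt_iff₀ hm] at h1
  rw [lt_div_iff₀ hm] at h2
  refine Eq.trans ?_ (autoconv_spline a hi (τ := m * s - i) (by linarith) (by linarith))
  congr 1
  field_simp
  ring

theorem cellMean_autoconv_spline (a : ℕ → ℝ) {i : ℕ} (hi : i < m) :
    cellMean m i (autoconv (spline m a)) = splineAutoconv m a i := by
  have hm : (0 : ℝ) < m := by exact_mod_cast (Nat.zero_le i).trans_lt hi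
  rw [cellMean_congr (autoconv_spline_eqOn a hi), splineAutoconv, cellMean]
  set A := cauchyProd a a i
  set B := delay (cauchyProd a a) i
  have h : ∀ s : ℝ, ((m * s - i) * A + (1 - (m * s - i)) * B) / m =
      (A - B) * s + (B - i * (A - B)) / m := fun s => by field_simp; ring
  simp only [h]
  rw [intervalIntegral.integral_add (Continuous.intervalIntegrable (by fun_prop) _ _)
    (Continuous.intervalIntegrable (by fun_prop) _ _),
    intervalIntegral.integral_const_mul, integral_id, intervalIntegral.integral_const, smul_eq_mul]
  field_simp
  ring

theorem intervalIntegrable_autoconv_spline (a : ℕ → ℝ) {i : ℕ} (hi : i < m) :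
    IntervalIntegrable (autoconv (spline m a)) volume ((i : ℝ) / m) (((i : ℝ) + 1) / m) := by
  refine IntervalIntegrable.congr_uIoo (f := fun s => ((m * s - i) * cauchyProd a a i +
      (1 - (m * s - i)) * delay (cauchyProd a a) i) / m) ?_ ?_
  · exact Continuous.intervalIntegrable (by fun_prop) _ _
  · rw [uIoo_of_le (cell_le m i)]
    exact (autoconv_spline_eqOn a hi).symm

/-! ### Lipschitz continuity of functions with a bounded weak derivative -/

/-- A normalized smooth bump of radius `ε` around `a`. -/
noncomputable def bump (a ε : ℝ) (hε : 0 < ε) : ℝ → ℝ :=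
  (⟨ε / 2, ε, half_pos hε, half_lt_self hε⟩ : ContDiffBump a).normed volume

section Bump

variable {a ε : ℝ} (hε : 0 < ε)

theorem contDiff_bump : ContDiff ℝ ∞ (bump a ε hε) := ContDiffBump.contDiff_normed _

theorem bump_nonneg (t : ℝ) : 0 ≤ bump a ε hε t := ContDiffBump.nonneg_normed _ t

theorem integral_bump : ∫ t, bump a ε hε t = 1 := ContDiffBump.integral_normed _

theorem integrable_bump : Integrable (bump a ε hε) := ContDiffBump.integrable_normed _

theorem support_bump : Function.support (bump a ε hε) = Ioo (a - ε) (a + ε) := by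
  rw [bump, ContDiffBump.support_normed_eq, Real.ball_eq_Ioo]

theorem bump_eq_zero {t : ℝ} (ht : t ∉ Ioo (a - ε) (a + ε)) : bump a ε hε t = 0 := by
  rw [← support_bump hε] at ht
  simpa using ht

theorem integral_bump_eq_one {b c : ℝ} (hb : b ≤ a - ε) (hc : a + ε ≤ c) :
    ∫ t in b..c, bump a ε hε t = 1 := by
  rw [intervalIntegral.integral_eq_integral_of_support_subset, integral_bump]
  rw [support_bump]
  exact fun t ht => ⟨hb.trans_lt ht.1, ht.2.le.trans hc⟩

theorem integral_bump_mem {b c : ℝ} (hbc : b ≤ c) :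
    0 ≤ ∫ t in b..c, bump a ε hε t ∧ ∫ t in b..c, bump a ε hε t ≤ 1 := by
  refine ⟨intervalIntegral.integral_nonneg hbc fun t _ => bump_nonneg hε t, ?_⟩
  rw [intervalIntegral.integral_of_le hbc, ← integral_bump hε (a := a)]
  exact setIntegral_le_integral (integrable_bump hε)
    (Filter.Eventually.of_forall (bump_nonneg hε))

/-- Averages against a bump are close to the value at its center. -/
theorem abs_integral_mul_bump_sub_le {u : ℝ → ℝ} (hu : ContinuousOn u (Icc 0 1))
    (h0 : 0 ≤ a - ε) (h1 : a + ε ≤ 1) {r : ℝ} (hr : ∀ t ∈ Ioo (a - ε) (a + ε), |u t - u a| ≤ r) :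
    |(∫ t in (0 : ℝ)..1, u t * bump a ε hε t) - u a| ≤ r := by
  have hcont : Continuous (bump a ε hε) := (contDiff_bump hε).continuous
  have hone := integral_bump_eq_one hε h0 h1
  have hi : IntervalIntegrable (fun t => u t * bump a ε hε t) volume 0 1 := by
    refine ContinuousOn.intervalIntegrable ?_
    rw [uIcc_of_le zero_le_one]
    exact hu.mul hcont.continuousOn
  have h2 : (∫ t in (0 : ℝ)..1, u t * bump a ε hε t) - u a =
      ∫ t in (0 : ℝ)..1, (u t * bump a ε hε t - u a * bump a ε hε t) := by
    rw [intervalIntegral.integral_sub hi (Continuous.intervalIntegrable (by fun_prop) _ _),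
      intervalIntegral.integral_const_mul, hone, mul_one]
  have h3 : ∫ t in (0 : ℝ)..1, r * bump a ε hε t = r := by
    rw [intervalIntegral.integral_const_mul, hone, mul_one]
  rw [h2, ← Real.norm_eq_abs]
  refine le_of_le_of_eq ?_ h3
  refine intervalIntegral.norm_integral_le_of_norm_le zero_le_one
    (Filter.Eventually.of_forall fun t _ => ?_) (Continuous.intervalIntegrable (by fun_prop) _ _)
  rw [← sub_mul, norm_mul, Real.norm_eq_abs, Real.norm_of_nonneg (bump_nonneg hε t)]
  by_cases ht : t ∈ Ioo (a - ε) (a + ε)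
  · exact mul_le_mul_of_nonneg_right (hr t ht) (bump_nonneg hε t)
  · rw [bump_eq_zero hε ht, mul_zero, mul_zero]

end Bump

/-- The weak derivative, tested with a primitive of the difference of two bumps, bounds the
difference of the averages of `u` against them. -/
theorem HasWeakDeriv.abs_integral_bump_sub_le {u v : ℝ → ℝ} {K : ℝ} (hu : ContinuousOn u (Icc 0 1))
    (h : HasWeakDeriv u v) (hv : ∀ᵐ s ∂unitMeasure, |v s| ≤ K) (hK : 0 ≤ K) {a b ε : ℝ}
    (hε : 0 < ε) (hab : a ≤ b) (ha : 0 < a - ε) (hb : b + ε < 1) :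
    |(∫ t in (0 : ℝ)..1, u t * bump a ε hε t) - ∫ t in (0 : ℝ)..1, u t * bump b ε hε t| ≤
      K * (b - a + 2 * ε) := by
  have hcA : Continuous (bump a ε hε) := (contDiff_bump hε).continuous
  have hcB : Continuous (bump b ε hε) := (contDiff_bump hε).continuous
  set φ : ℝ → ℝ := fun s => ∫ t in (0 : ℝ)..s, (bump a ε hε t - bump b ε hε t) with hφ
  have hderiv : ∀ s, HasDerivAt φ (bump a ε hε s - bump b ε hε s) s := fun s =>
    intervalIntegral.integral_hasDerivAt_right ((hcA.sub hcB).intervalIntegrable _ _)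
      ((hcA.sub hcB).stronglyMeasurableAtFilter _ _) (hcA.sub hcB).continuousAt
  have hderiv' : deriv φ = fun s => bump a ε hε s - bump b ε hε s :=
    funext fun s => (hderiv s).deriv
  have hsmooth : ContDiff ℝ ∞ φ := by
    rw [contDiff_infty_iff_deriv, hderiv']
    exact ⟨fun s => (hderiv s).differentiableAt, (contDiff_bump hε).sub (contDiff_bump hε)⟩
  have hφ2 : ∀ s, φ s = (∫ t in (0 : ℝ)..s, bump a ε hε t) - ∫ t in (0 : ℝ)..s, bump b ε hε t :=
    fun s => intervalIntegral.integral_sub (hcA.intervalIntegrable _ _) (hcB.intervalIntegrable _ _)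
  -- Both bumps have integral `1`, so `φ` vanishes to the right of them as well.
  have hφ0 : ∀ s, s ∉ Icc (a - ε) (b + ε) → φ s = 0 := by
    intro s hs
    rcases lt_or_ge s (a - ε) with h1 | h1
    · refine intervalIntegral.integral_zero_ae (Filter.Eventually.of_forall fun t ht => ?_)
      have ht' : t ≤ a - ε := ht.2.trans (max_le ha.le h1.le)
      rw [bump_eq_zero hε fun h => by linarith [h.1], bump_eq_zero hε fun h => by linarith [h.1],
        sub_zero]
    · have h2 : b + ε < s := by
        by_contra h3
        exact hs ⟨h1, not_lt.1 h3⟩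
      rw [hφ2, integral_bump_eq_one hε ha.le (by linarith),
        integral_bump_eq_one hε (by linarith) h2.le, sub_self]
  have hts : tsupport φ ⊆ Icc (a - ε) (b + ε) :=
    closure_minimal (fun s hs => by by_contra h1; exact hs (hφ0 s h1)) isClosed_Icc
  have hφ1 : ∀ s, 0 ≤ s → |φ s| ≤ 1 := by
    intro s hs
    have h1 := integral_bump_mem hε (a := a) hs
    have h2 := integral_bump_mem hε (a := b) hs
    rw [hφ2, abs_le]
    constructor <;> linarith
  have hcs : HasCompactSupport φ := isCompact_Icc.of_isClosed_subset (isClosed_tsupport φ) hts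
  have key := h φ hsmooth hcs
    (hts.trans fun s hs => ⟨ha.trans_le hs.1, hs.2.trans_lt hb⟩)
  have hi : ∀ {g : ℝ → ℝ}, Continuous g → IntervalIntegrable (fun t => u t * g t) volume 0 1 := by
    intro g hg
    refine ContinuousOn.intervalIntegrable ?_
    rw [uIcc_of_le zero_le_one]
    exact hu.mul hg.continuousOn
  rw [hderiv'] at key
  simp only [mul_sub] at key
  rw [intervalIntegral.integral_sub (hi hcA) (hi hcB)] at key
  rw [key, abs_neg, ← Real.norm_eq_abs, intervalIntegral.integral_of_le zero_le_one,
    integral_Ioc_eq_integral_Ioo]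
  have hbound : ∀ᵐ s ∂unitMeasure, ‖v s * φ s‖ ≤
      (Icc (a - ε) (b + ε)).indicator (fun _ => K) s := by
    filter_upwards [hv, ae_restrict_mem measurableSet_Ioo] with s hs hs'
    by_cases h1 : s ∈ Icc (a - ε) (b + ε)
    · rw [indicator_of_mem h1, norm_mul]
      exact (mul_le_mul hs (hφ1 s hs'.1.le) (abs_nonneg _) hK).trans (mul_one K).le
    · rw [indicator_of_notMem h1, hφ0 s h1, mul_zero, norm_zero]
  have hint : Integrable ((Icc (a - ε) (b + ε)).indicator (fun _ => K)) (volume : Measure ℝ) :=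
    (integrable_indicator_iff measurableSet_Icc).2 (by simp)
  refine (norm_integral_le_of_norm_le hint.integrableOn hbound).trans ?_
  refine (setIntegral_le_integral hint
    (Filter.Eventually.of_forall fun s => indicator_nonneg (fun _ _ => hK) s)).trans ?_
  rw [integral_indicator_const _ measurableSet_Icc, Real.volume_real_Icc_of_le (by linarith),
    smul_eq_mul]
  linarith

theorem HasWeakDeriv.abs_sub_le_of_mem_Ioo {u v : ℝ → ℝ} {K : ℝ} (hu : ContinuousOn u (Icc 0 1))
    (h : HasWeakDeriv u v) (hv : ∀ᵐ s ∂unitMeasure, |v s| ≤ K) (hK : 0 ≤ K) {a b : ℝ}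
    (ha : 0 < a) (hab : a ≤ b) (hb : b < 1) : |u a - u b| ≤ K * (b - a) := by
  refine le_of_forall_pos_le_add fun r hr => ?_
  have hr' : 0 < r / (2 + 2 * K) := by positivity
  have hcont : ∀ c ∈ Ioo (0 : ℝ) 1, ∃ η > 0, ∀ t, |t - c| < η → |u t - u c| ≤ r / (2 + 2 * K) := by
    intro c hc
    obtain ⟨η, hη, hη'⟩ := Metric.continuousAt_iff.1
      (hu.continuousAt (Icc_mem_nhds hc.1 hc.2)) _ hr'
    exact ⟨η, hη, fun t ht => (hη' ht).le⟩
  obtain ⟨η₁, hη₁, h₁⟩ := hcont a ⟨ha, hab.trans_lt hb⟩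
  obtain ⟨η₂, hη₂, h₂⟩ := hcont b ⟨ha.trans_le hab, hb⟩
  obtain ⟨ε, hε, hε'⟩ : ∃ ε > 0, ε < η₁ ∧ ε < η₂ ∧ ε < a ∧ ε < 1 - b ∧ ε < r / (2 + 2 * K) := by
    refine ⟨(min η₁ (min η₂ (min a (min (1 - b) (r / (2 + 2 * K)))))) / 2, ?_, ?_⟩
    · have := sub_pos.2 hb
      positivity
    · have hpos : 0 < min η₁ (min η₂ (min a (min (1 - b) (r / (2 + 2 * K))))) := by
        have := sub_pos.2 hb
        positivity
      have hlt := half_lt_self hpos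
      simpa only [lt_min_iff] using hlt
  obtain ⟨e1, e2, e3, e4, e5⟩ := hε'
  have k1 := h.abs_integral_bump_sub_le hu hv hK hε hab (by linarith) (by linarith)
  have k2 := abs_integral_mul_bump_sub_le hε hu (a := a) (by linarith) (by linarith)
    fun t ht => h₁ t (by rw [abs_lt]; constructor <;> linarith [ht.1, ht.2])
  have k3 := abs_integral_mul_bump_sub_le hε hu (a := b) (by linarith) (by linarith)
    fun t ht => h₂ t (by rw [abs_lt]; constructor <;> linarith [ht.1, ht.2])
  have k4 : (2 + 2 * K) * (r / (2 + 2 * K)) = r := mul_div_cancel₀ _ (by positivity)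
  have k5 : K * ε ≤ K * (r / (2 + 2 * K)) := by gcongr
  rw [abs_le] at k1 k2 k3 ⊢
  constructor <;> nlinarith

theorem HasWeakDeriv.abs_sub_le {u v : ℝ → ℝ} {K : ℝ} (hu : ContinuousOn u (Icc 0 1))
    (h : HasWeakDeriv u v) (hv : ∀ᵐ s ∂unitMeasure, |v s| ≤ K) (hK : 0 ≤ K) {a b : ℝ}
    (ha : a ∈ Icc (0 : ℝ) 1) (hb : b ∈ Icc (0 : ℝ) 1) : |u a - u b| ≤ K * |a - b| := by
  have hcl : closure (Ioo (0 : ℝ) 1 ×ˢ Ioo (0 : ℝ) 1) = Icc (0 : ℝ) 1 ×ˢ Icc (0 : ℝ) 1 := by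
    rw [closure_prod_eq, closure_Ioo zero_ne_one]
  have hu1 : ContinuousOn (fun q : ℝ × ℝ => u q.1) (Icc (0 : ℝ) 1 ×ˢ Icc (0 : ℝ) 1) :=
    hu.comp continuousOn_fst fun q hq => hq.1
  have hu2 : ContinuousOn (fun q : ℝ × ℝ => u q.2) (Icc (0 : ℝ) 1 ×ˢ Icc (0 : ℝ) 1) :=
    hu.comp continuousOn_snd fun q hq => hq.2
  refine le_on_closure (f := fun q : ℝ × ℝ => |u q.1 - u q.2|) (g := fun q => K * |q.1 - q.2|)
    (s := Ioo (0 : ℝ) 1 ×ˢ Ioo (0 : ℝ) 1) ?_ (hcl ▸ (hu1.sub hu2).abs) (by fun_prop)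
    (x := (a, b)) (hcl ▸ ⟨ha, hb⟩)
  rintro ⟨x, y⟩ ⟨hx, hy⟩
  rcases le_total x y with hxy | hxy
  · have := h.abs_sub_le_of_mem_Ioo hu hv hK hx.1 hxy hy.2
    simpa [abs_of_nonpos (sub_nonpos.2 hxy)] using this
  · have := h.abs_sub_le_of_mem_Ioo hu hv hK hy.1 hxy hx.2
    rw [abs_sub_comm] at this
    simpa [abs_of_nonneg (sub_nonneg.2 hxy)] using this

/-- An element of `W²_∞(0,1)` that is continuous on `[0,1]` is Lipschitz continuous there. -/
theorem MemW2Infty.exists_lipschitzOnWith {u : ℝ → ℝ} (h : MemW2Infty u)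
    (hu : ContinuousOn u (Icc 0 1)) : ∃ K, LipschitzOnWith K u (Icc 0 1) := by
  obtain ⟨-, v, -, hv, -, huv, -⟩ := h
  refine ⟨(eLpNorm v ⊤ unitMeasure).toNNReal, LipschitzOnWith.of_dist_le_mul fun a ha b hb => ?_⟩
  refine huv.abs_sub_le hu ?_ NNReal.zero_le_coe ha hb
  have hfin : eLpNormEssSup v unitMeasure ≠ ⊤ := by
    have := hv.2.ne
    rwa [eLpNorm_exponent_top] at this
  filter_upwards [ae_le_eLpNormEssSup (f := v) (μ := unitMeasure)] with s hs
  rw [eLpNorm_exponent_top]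
  have := ENNReal.toReal_mono hfin hs
  rwa [toReal_enorm, Real.norm_eq_abs] at this

/-! ### Data and discretization errors -/

section Errors

variable {u : ℝ → ℝ} {L M : ℝ}

theorem autoconv_congr {x : ℝ → ℝ} (h : EqOn x u (Icc 0 1)) :
    EqOn (autoconv x) (autoconv u) (Icc 0 1) := by
  intro s hs
  refine intervalIntegral.integral_congr fun t ht => ?_
  rw [uIcc_of_le hs.1] at ht
  rw [h ⟨ht.1, ht.2.trans hs.2⟩, h ⟨sub_nonneg.2 ht.2, by linarith [ht.1, hs.2]⟩]

theorem continuous_autoconv (hu : Continuous u) : Continuous (autoconv u) :=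
  intervalIntegral.continuous_parametric_intervalIntegral_of_continuous (a₀ := 0)
    (f := fun s t => u (s - t) * u t) (by fun_prop) continuous_id

theorem measurable_spline (m : ℕ) (a : ℕ → ℝ) : Measurable (spline m a) := by
  have h : Measurable fun s : ℝ => ⌊(m : ℝ) * s⌋₊ := Nat.measurable_floor.comp (by fun_prop)
  exact (measurable_from_nat (f := fun k : ℕ => a (min k (m - 1)))).comp h

theorem cellIndex_div_le (hm : 0 < m) {s : ℝ} (hs : s ∈ Icc (0 : ℝ) 1) :
    (cellIndex m s : ℝ) / m ≤ s ∧ s ≤ ((cellIndex m s : ℝ) + 1) / m := by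
  have h2 : (0 : ℝ) < m := by exact_mod_cast hm
  have h3 : (0 : ℝ) ≤ m * s := mul_nonneg h2.le hs.1
  rw [div_le_iff₀ h2, le_div_iff₀ h2, mul_comm s]
  constructor
  · have h4 : ((cellIndex m s : ℕ) : ℝ) ≤ (⌊(m : ℝ) * s⌋₊ : ℝ) := by
      exact_mod_cast min_le_left _ _
    exact h4.trans (Nat.floor_le h3)
  · rcases le_total ⌊(m : ℝ) * s⌋₊ (m - 1) with h | h
    · rw [cellIndex, min_eq_left h]
      exact (Nat.lt_floor_add_one _).le
    · rw [cellIndex, min_eq_right h, Nat.cast_sub (by omega)]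
      push_cast
      nlinarith [hs.2]

theorem abs_sub_spline_le (hm : 0 < m) (hL : 0 ≤ L) (hu : ∀ a b, |u a - u b| ≤ L * |a - b|) {t : ℝ}
    (ht : t ∈ Icc (0 : ℝ) 1) : |u t - spline m (fun j => u (j / m)) t| ≤ L / m := by
  have h2 : (0 : ℝ) < m := by exact_mod_cast hm
  have h := cellIndex_div_le hm ht
  refine (hu _ _).trans ?_
  rw [abs_of_nonneg (by linarith [h.1]), div_eq_mul_one_div L]
  gcongr
  have := h.2
  rw [add_div] at this
  linarith

theorem abs_mul_sub_mul_le {a b a' b' r : ℝ} (hb : |b| ≤ M) (ha' : |a'| ≤ M) (h1 : |a - a'| ≤ r)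
    (h2 : |b - b'| ≤ r) : |a * b - a' * b'| ≤ 2 * M * r := by
  rw [show a * b - a' * b' = (a - a') * b + a' * (b - b') by ring]
  refine (abs_add_le _ _).trans ?_
  rw [abs_mul, abs_mul]
  have h3 : |a - a'| * |b| ≤ r * M := mul_le_mul h1 hb (abs_nonneg _) ((abs_nonneg _).trans h1)
  have h4 : |a'| * |b - b'| ≤ M * r := mul_le_mul ha' h2 (abs_nonneg _) ((abs_nonneg _).trans ha')
  linarith

theorem continuous_of_abs_sub_le (hL : 0 ≤ L) (hu : ∀ a b, |u a - u b| ≤ L * |a - b|) :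
    Continuous u :=
  (LipschitzWith.of_dist_le_mul (K := ⟨L, hL⟩) fun a b => hu a b).continuous

theorem abs_autoconv_sub_autoconv_spline_le (hm : 0 < m) (hL : 0 ≤ L)
    (hu : ∀ a b, |u a - u b| ≤ L * |a - b|) (hM : ∀ t, |u t| ≤ M) {s : ℝ}
    (hs : s ∈ Icc (0 : ℝ) 1) :
    |autoconv u s - autoconv (spline m fun j => u (j / m)) s| ≤ 2 * M * (L / m) := by
  have hM0 : 0 ≤ M := (abs_nonneg _).trans (hM 0)
  have hc := continuous_of_abs_sub_le hL hu
  set P := spline m fun j => u (j / m) with hP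
  have hPm : Measurable P := measurable_spline _ _
  have hPM : ∀ t, |P t| ≤ M := fun t => hM _
  have hi : IntervalIntegrable (fun t => P (s - t) * P t) volume 0 s := by
    rw [intervalIntegrable_iff_integrableOn_Ioc_of_le hs.1]
    refine Measure.integrableOn_of_bounded (M := M * M) (by simp)
      ((hPm.comp (measurable_const.sub measurable_id)).mul hPm).aestronglyMeasurable
      (Filter.Eventually.of_forall fun t => ?_)
    rw [norm_mul]
    exact mul_le_mul (hPM _) (hPM _) (norm_nonneg _) hM0
  rw [autoconv, autoconv, ← intervalIntegral.integral_sub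
    (Continuous.intervalIntegrable (by fun_prop) _ _) hi]
  refine (intervalIntegral.norm_integral_le_of_norm_le_const (C := 2 * M * (L / m))
    (f := fun t => u (s - t) * u t - P (s - t) * P t) fun t ht => ?_).trans ?_
  · rw [uIoc_of_le hs.1] at ht
    exact abs_mul_sub_mul_le (hM _) (hPM _)
      (abs_sub_spline_le hm hL hu ⟨sub_nonneg.2 ht.2, by linarith [ht.1, hs.2]⟩)
      (abs_sub_spline_le hm hL hu ⟨ht.1.le, ht.2.trans hs.2⟩)
  · rw [sub_zero, abs_of_nonneg hs.1]
    exact mul_le_of_le_one_right (by positivity) hs.2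

theorem abs_autoconv_sub_mul_sq_le (hL : 0 ≤ L) (hu : ∀ a b, |u a - u b| ≤ L * |a - b|)
    (hM : ∀ t, |u t| ≤ M) {s : ℝ} (hs : 0 ≤ s) :
    |autoconv u s - s * u 0 ^ 2| ≤ 2 * M * L * s ^ 2 := by
  have hc := continuous_of_abs_sub_le hL hu
  have h1 : s * u 0 ^ 2 = ∫ _t in (0 : ℝ)..s, u 0 * u 0 := by
    rw [intervalIntegral.integral_const, smul_eq_mul]; ring
  rw [h1, autoconv, ← intervalIntegral.integral_sub
    (Continuous.intervalIntegrable (by fun_prop) _ _) (by simp)]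
  refine (intervalIntegral.norm_integral_le_of_norm_le_const (C := 2 * M * (L * s))
    (f := fun t => u (s - t) * u t - u 0 * u 0) fun t ht => ?_).trans (le_of_eq ?_)
  · rw [uIoc_of_le hs] at ht
    refine abs_mul_sub_mul_le (hM _) (hM _) ((hu _ _).trans ?_) ((hu _ _).trans ?_)
    · rw [sub_zero, abs_of_nonneg (sub_nonneg.2 ht.2)]
      gcongr
      linarith [ht.1]
    · rw [sub_zero, abs_of_pos ht.1]
      gcongr
      exact ht.2
  · rw [sub_zero, abs_of_nonneg hs]
    ring

theorem abs_cellMean_sub_le (hm : 0 < m) {i : ℕ} {f g : ℝ → ℝ} {r : ℝ}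
    (hf : IntervalIntegrable f volume ((i : ℝ) / m) (((i : ℝ) + 1) / m))
    (hg : IntervalIntegrable g volume ((i : ℝ) / m) (((i : ℝ) + 1) / m))
    (h : ∀ᵐ t, t ∈ Ioc ((i : ℝ) / m) (((i : ℝ) + 1) / m) → |f t - g t| ≤ r) :
    |cellMean m i f - cellMean m i g| ≤ r := by
  have h2 : (0 : ℝ) < m := by exact_mod_cast hm
  rw [cellMean, cellMean, ← mul_sub, ← intervalIntegral.integral_sub hf hg, abs_mul, abs_of_pos h2]
  have h3 := intervalIntegral.norm_integral_le_of_norm_le_const_ae (C := r)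
    (f := fun t => f t - g t) (a := (i : ℝ) / m) (b := ((i : ℝ) + 1) / m)
    (by rw [uIoc_of_le (cell_le m i)]; exact h)
  rw [← sub_div, add_sub_cancel_left, abs_of_pos (by positivity), Real.norm_eq_abs] at h3
  calc _ ≤ m * (r * (1 / m)) := by gcongr
    _ = r := by field_simp

theorem cell_subset {i : ℕ} (hi : i < m) :
    Icc ((i : ℝ) / m) (((i : ℝ) + 1) / m) ⊆ Icc 0 1 := by
  have hm : (0 : ℝ) < m := by exact_mod_cast (Nat.zero_le i).trans_lt hi
  refine Icc_subset_Icc (by positivity) ?_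
  rw [div_le_one hm]
  exact_mod_cast hi

theorem ae_mem_cell_of_ae_unitMeasure {p : ℝ → Prop} (h : ∀ᵐ t ∂unitMeasure, p t) {i : ℕ}
    (hi : i < m) : ∀ᵐ t, t ∈ Ioc ((i : ℝ) / m) (((i : ℝ) + 1) / m) → p t := by
  rw [unitMeasure, restrict_Ioo_eq_restrict_Ioc, ae_restrict_iff' measurableSet_Ioc] at h
  filter_upwards [h] with t ht ht'
  refine ht ⟨lt_of_le_of_lt (by positivity) ht'.1, (cell_subset hi ⟨ht'.1.le, ht'.2⟩).2⟩

theorem IsNoisyData.intervalIntegrable {y : ℝ → ℝ} {δ : ℝ} (h : IsNoisyData u y δ)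
    (hu : Continuous u) {i : ℕ} (hi : i < m) :
    IntervalIntegrable y volume ((i : ℝ) / m) (((i : ℝ) + 1) / m) := by
  have hc := continuous_autoconv hu
  have hfin : IsFiniteMeasure unitMeasure := by unfold unitMeasure; infer_instance
  have h1 : Integrable (fun s => y s - autoconv u s) unitMeasure :=
    Integrable.of_bound (h.1.sub hc.aestronglyMeasurable) δ h.2
  have h2 : IntervalIntegrable (fun s => y s - autoconv u s) volume 0 1 := by
    rw [intervalIntegrable_iff_integrableOn_Ioo_of_le zero_le_one]
    exact h1
  have h3 : IntervalIntegrable y volume 0 1 := by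
    simpa using h2.add (hc.intervalIntegrable 0 1)
  refine h3.mono_set ?_
  rw [uIcc_of_le (cell_le m i), uIcc_of_le zero_le_one]
  exact cell_subset hi

theorem abs_cellMean_sub_splineAutoconv_le (hm : 0 < m) (hL : 0 ≤ L)
    (hu : ∀ a b, |u a - u b| ≤ L * |a - b|) (hM : ∀ t, |u t| ≤ M) {y : ℝ → ℝ} {δ : ℝ}
    (hy : IsNoisyData u y δ) {i : ℕ} (hi : i < m) :
    |cellMean m i y - splineAutoconv m (fun j => u (j / m)) i| ≤ δ + 2 * M * (L / m) := by
  have hc := continuous_of_abs_sub_le hL hu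
  rw [← cellMean_autoconv_spline _ hi]
  refine abs_cellMean_sub_le hm (hy.intervalIntegrable hc hi)
    (intervalIntegrable_autoconv_spline _ hi) ?_
  filter_upwards [ae_mem_cell_of_ae_unitMeasure hy.2 hi] with t ht ht'
  exact (abs_sub_le _ (autoconv u t) _).trans (add_le_add (ht ht')
    (abs_autoconv_sub_autoconv_spline_le hm hL hu hM (cell_subset hi ⟨ht'.1.le, ht'.2⟩)))

/-- The value of the projected data at `√δ` is `√δ u(0)²` up to `O(δ)`: all points of the cell of `√δ`
are within `1 / m ≤ δ` of `√δ`. -/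
theorem abs_splineProj_sqrt_sub_le (hm : 0 < m) (hL : 0 ≤ L)
    (hu : ∀ a b, |u a - u b| ≤ L * |a - b|) (hM : ∀ t, |u t| ≤ M) {y : ℝ → ℝ} {δ : ℝ}
    (hδ : 0 < δ) (hδ1 : δ ≤ 1) (hmδ : 1 ≤ m * δ) (hy : IsNoisyData u y δ) :
    |splineProj m y √δ - √δ * u 0 ^ 2| ≤ (1 + u 0 ^ 2 + 8 * M * L) * δ := by
  have h2 : (0 : ℝ) < m := by exact_mod_cast hm
  have hM0 : 0 ≤ M := (abs_nonneg _).trans (hM 0)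
  have hc := continuous_of_abs_sub_le hL hu
  have hsq : √δ ^ 2 = δ := Real.sq_sqrt hδ.le
  have hs0 : 0 ≤ √δ := Real.sqrt_nonneg δ
  have hs1 : √δ ≤ 1 := Real.sqrt_le_one.2 hδ1
  have hδs : δ ≤ √δ := by nlinarith
  have hcell := cellIndex_div_le hm ⟨hs0, hs1⟩
  have hi := cellIndex_lt hm √δ
  rw [splineProj]
  set i := cellIndex m √δ
  have h1m : 1 / (m : ℝ) ≤ δ := by rw [div_le_iff₀ h2]; linarith
  rw [← cellMean_const hm i (√δ * u 0 ^ 2)]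
  refine abs_cellMean_sub_le hm (hy.intervalIntegrable hc hi) (by simp) ?_
  filter_upwards [ae_mem_cell_of_ae_unitMeasure hy.2 hi] with t ht ht'
  have ht0 : 0 ≤ t := (cell_subset hi ⟨ht'.1.le, ht'.2⟩).1
  have hts : |t - √δ| ≤ δ := by
    have h3 := hcell.1
    have h4 := hcell.2
    have h5 := ht'.1
    have h6 := ht'.2
    rw [add_div] at h4 h6
    rw [abs_le]
    constructor <;> linarith
  have ht2 : t ^ 2 ≤ 4 * δ := by
    have : t ≤ 2 * √δ := by linarith [(abs_le.1 hts).2]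
    nlinarith
  calc |y t - √δ * u 0 ^ 2| = |(y t - autoconv u t) + (autoconv u t - t * u 0 ^ 2) +
        (t - √δ) * u 0 ^ 2| := by congr 1; ring
    _ ≤ δ + 2 * M * L * t ^ 2 + δ * u 0 ^ 2 := by
        refine (abs_add_le _ _).trans (add_le_add ((abs_add_le _ _).trans (add_le_add (ht ht')
          (abs_autoconv_sub_mul_sq_le hL hu hM ht0))) ?_)
        rw [abs_mul, abs_of_nonneg (sq_nonneg (u 0))]
        gcongr
    _ ≤ δ + 2 * M * L * (4 * δ) + δ * u 0 ^ 2 := by gcongr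
    _ = _ := by ring

/-- The reference value is accurate of order `√δ`, since `[F(u)](s) = s u(0)² + O(s²)`. -/
theorem abs_refValue_sub_le (hm : 0 < m) (hL : 0 ≤ L)
    (hu : ∀ a b, |u a - u b| ≤ L * |a - b|) (hM : ∀ t, |u t| ≤ M) (hu0 : 0 < u 0) {y : ℝ → ℝ}
    {δ : ℝ} (hδ : 0 < δ) (hδ1 : δ ≤ 1) (hmδ : 1 ≤ m * δ) (hy : IsNoisyData u y δ) :
    |refValue m δ y - u 0| ≤ (1 + u 0 ^ 2 + 8 * M * L) / u 0 * √δ := by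
  have h := abs_splineProj_sqrt_sub_le hm hL hu hM hδ hδ1 hmδ hy
  have hs : 0 < √δ := Real.sqrt_pos.2 hδ
  have hsq : δ = √δ * √δ := (Real.mul_self_sqrt hδ.le).symm
  set B := 1 + u 0 ^ 2 + 8 * M * L
  set v := splineProj m y √δ with hv
  rw [div_mul_eq_mul_div, le_div_iff₀ hu0, refValue, ← hv]
  split_ifs with hv0
  · set r := √(1 / √δ * v) with hr
    have hr0 : 0 ≤ r := Real.sqrt_nonneg _
    have hr2 : √δ * r ^ 2 = v := by
      rw [hr, Real.sq_sqrt (by positivity)]; field_simp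
    have h3 : |r ^ 2 - u 0 ^ 2| ≤ B * √δ := by
      refine le_of_mul_le_mul_left ?_ hs
      calc √δ * |r ^ 2 - u 0 ^ 2| = |v - √δ * u 0 ^ 2| := by
            rw [← hr2, ← mul_sub, abs_mul, abs_of_pos hs]
        _ ≤ B * δ := h
        _ = √δ * (B * √δ) := by rw [mul_left_comm, ← hsq]
    calc |r - u 0| * u 0 ≤ |r - u 0| * |r + u 0| := by
          gcongr; rw [abs_of_pos (by positivity)]; linarith
      _ = |r ^ 2 - u 0 ^ 2| := by rw [← abs_mul]; congr 1; ring
      _ ≤ _ := h3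
  · rw [zero_sub, abs_neg, abs_of_pos hu0]
    refine le_of_mul_le_mul_left ?_ hs
    have h3 := (abs_le.1 h).1
    rw [mul_left_comm √δ B, ← hsq]
    nlinarith

theorem intervalIntegrable_and_integral_spline (hm : 0 < m) (b : ℕ → ℝ) :
    IntervalIntegrable (spline m b) volume 0 1 ∧
      ∫ t in (0 : ℝ)..1, spline m b t = (∑ i ∈ Finset.range m, b i) / m := by
  have h2 : (m : ℝ) ≠ 0 := by exact_mod_cast hm.ne'
  have h : ∀ i < m, IntervalIntegrable (spline m b) volume ((fun k : ℕ => (k : ℝ) / m) i)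
      ((fun k : ℕ => (k : ℝ) / m) (i + 1)) ∧
      ∫ t in ((fun k : ℕ => (k : ℝ) / m) i)..((fun k : ℕ => (k : ℝ) / m) (i + 1)),
        spline m b t = b i / m := fun i hi => by
    have h3 := integrable_and_integral_of_eqOn_const (f := spline m b) (cell_le m i)
      fun t ht ht' => spline_eq_of_mem b hi ht.le ht'
    push_cast
    refine ⟨h3.1, h3.2.trans ?_⟩
    field_simp
    ring
  have h3 := intervalIntegral.sum_integral_adjacent_intervals fun k hk => (h k hk).1
  have h4 := IntervalIntegrable.trans_iterate fun k hk => (h k hk).1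
  simp only [Nat.cast_zero, zero_div, div_self h2] at h3 h4
  refine ⟨h4, ?_⟩
  rw [← h3, Finset.sum_div]
  exact Finset.sum_congr rfl fun i hi => (h i (Finset.mem_range.1 hi)).2

/-- A weighted norm of the distance to a spline with coefficients `a` is controlled by a discrete
weighted norm of the distance of the coefficients from the grid values. -/
theorem integral_mul_sq_sub_spline_le (hm : 0 < m) (hL : 0 ≤ L)
    (hu : ∀ a b, |u a - u b| ≤ L * |a - b|) {σ α κ : ℝ} (hσ : 0 ≤ σ) (hκ : 0 ≤ κ)
    {w x : ℝ → ℝ} (hx : EqOn x u (Icc 0 1)) {a : ℕ → ℝ} (hw : ∀ t ∈ Icc (0 : ℝ) 1, 0 ≤ w t)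
    (hwκ : ∀ t ∈ Icc (0 : ℝ) 1, w t ≤ κ * Real.exp (-2 * σ * t))
    (hLm : L / m ≤ α / 8)
    (ha : ∑ i ∈ Finset.range m, (Real.exp (-(σ / m)) ^ i * (a i - u (i / m))) ^ 2 ≤
      m * (α / 8) ^ 2) :
    ∫ t in (0 : ℝ)..1, w t * (x t - spline m a t) ^ 2 ≤ κ * α ^ 2 := by
  have h2 : (0 : ℝ) < m := by exact_mod_cast hm
  set b : ℕ → ℝ := fun i => (Real.exp (-(σ / m)) ^ i * (a i - u (i / m))) ^ 2 with hb
  obtain ⟨hbi, hbint⟩ := intervalIntegrable_and_integral_spline hm b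
  have hpt : ∀ t ∈ Icc (0 : ℝ) 1, w t * (x t - spline m a t) ^ 2 ≤
      κ * (2 * (α / 8) ^ 2 + 2 * spline m b t) := by
    intro t ht
    have hcell := (cellIndex_div_le hm ht).1
    have hsp := (abs_sub_spline_le hm hL hu ht).trans hLm
    have hLm0 : 0 ≤ α / 8 := (by positivity : 0 ≤ L / m).trans hLm
    rw [hx ht]
    simp only [spline, hb] at hsp ⊢
    set i := cellIndex m t
    have hexp : Real.exp (-2 * σ * t) ≤ (Real.exp (-(σ / m)) ^ i) ^ 2 := by
      rw [← pow_mul, ← Real.exp_nat_mul, Real.exp_le_exp]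
      push_cast
      have := mul_le_mul_of_nonneg_left hcell (by linarith : 0 ≤ 2 * σ)
      calc -2 * σ * t ≤ -(2 * σ * (i / m)) := by linarith
        _ = _ := by ring
    have hexp1 : Real.exp (-2 * σ * t) ≤ 1 := by
      rw [Real.exp_le_one_iff]
      nlinarith [mul_nonneg hσ ht.1]
    have h3 : (u t - a i) ^ 2 ≤ 2 * (u t - u (i / m)) ^ 2 + 2 * (a i - u (i / m)) ^ 2 := by
      nlinarith [sq_nonneg ((u t - u (i / m)) + (a i - u (i / m)))]
    have h4 : (u t - u (i / m)) ^ 2 ≤ (α / 8) ^ 2 := sq_le_sq' (by linarith [(abs_le.1 hsp).1])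
      (abs_le.1 hsp).2
    calc w t * (u t - a i) ^ 2 ≤ κ * Real.exp (-2 * σ * t) * (u t - a i) ^ 2 := by
          gcongr; exact hwκ t ht
      _ ≤ κ * Real.exp (-2 * σ * t) * (2 * (α / 8) ^ 2 + 2 * (a i - u (i / m)) ^ 2) := by
          gcongr; linarith
      _ = κ * (Real.exp (-2 * σ * t) * (2 * (α / 8) ^ 2) +
          2 * (Real.exp (-2 * σ * t) * (a i - u (i / m)) ^ 2)) := by ring
      _ ≤ κ * (1 * (2 * (α / 8) ^ 2) +
          2 * ((Real.exp (-(σ / m)) ^ i) ^ 2 * (a i - u (i / m)) ^ 2)) := by gcongr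
      _ = _ := by ring
  have hgi : IntervalIntegrable (fun t => κ * (2 * (α / 8) ^ 2 + 2 * spline m b t)) volume 0 1 :=
    (intervalIntegrable_const.add (hbi.const_mul 2)).const_mul κ
  calc ∫ t in (0 : ℝ)..1, w t * (x t - spline m a t) ^ 2
      ≤ ∫ t in (0 : ℝ)..1, κ * (2 * (α / 8) ^ 2 + 2 * spline m b t) := by
        rw [intervalIntegral.integral_of_le zero_le_one, intervalIntegral.integral_of_le zero_le_one]
        refine integral_mono_of_nonneg ?_
          ((intervalIntegrable_iff_integrableOn_Ioc_of_le zero_le_one).1 hgi) ?_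
        · filter_upwards [ae_restrict_mem measurableSet_Ioc] with t ht
          exact mul_nonneg (hw t ⟨ht.1.le, ht.2⟩) (sq_nonneg _)
        · filter_upwards [ae_restrict_mem measurableSet_Ioc] with t ht
          exact hpt t ⟨ht.1.le, ht.2⟩
    _ = κ * (2 * (α / 8) ^ 2 + 2 * ((∑ i ∈ Finset.range m, b i) / m)) := by
        rw [intervalIntegral.integral_const_mul, intervalIntegral.integral_add
          intervalIntegrable_const (hbi.const_mul 2), intervalIntegral.integral_const_mul 2 (spline m b),
          hbint]
        simp
    _ ≤ κ * (2 * (α / 8) ^ 2 + 2 * (α / 8) ^ 2) := by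
        gcongr
        rw [div_le_iff₀ h2]
        linarith
    _ ≤ κ * α ^ 2 := by
        gcongr
        nlinarith [sq_nonneg α]

end Errors

/-! ### The convergence rate -/

/-- The values outside `[0,1]` are replaced by those at the end points, to have bounds on all of
`ℝ`. -/
theorem IsAdmissibleSolution.exists_lipschitz_extension {x₀ : ℝ → ℝ} (h : IsAdmissibleSolution x₀) :
    ∃ (u : ℝ → ℝ) (L : ℝ), 0 ≤ L ∧ EqOn x₀ u (Icc 0 1) ∧ (∀ a b, |u a - u b| ≤ L * |a - b|) ∧
      (∀ t, |u t| ≤ u 0 + L) ∧ 0 < u 0 := by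
  obtain ⟨K, hK⟩ := h.memW2Infty.exists_lipschitzOnWith h.continuousOn
  have hmem : ∀ t : ℝ, max 0 (min 1 t) ∈ Icc (0 : ℝ) 1 := fun t =>
    ⟨le_max_left _ _, max_le zero_le_one (min_le_left _ _)⟩
  have hpos : 0 < x₀ 0 := h.pos 0 ⟨le_rfl, zero_lt_one⟩
  have hcl : ∀ a b : ℝ, |max 0 (min 1 a) - max 0 (min 1 b)| ≤ |a - b| := fun a b =>
    (abs_max_sub_max_le_max _ _ _ _).trans (max_le (by simp)
      ((abs_min_sub_min_le_max _ _ _ _).trans (max_le (by simp) le_rfl)))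
  have hlip : ∀ a ∈ Icc (0 : ℝ) 1, ∀ b ∈ Icc (0 : ℝ) 1, |x₀ a - x₀ b| ≤ K * |a - b| :=
    fun a ha b hb => hK.dist_le_mul a ha b hb
  refine ⟨fun t => x₀ (max 0 (min 1 t)), K, K.2, fun t ht => ?_, fun a b => ?_, fun t => ?_, ?_⟩
  · simp [ht.1, ht.2]
  · exact (hlip _ (hmem a) _ (hmem b)).trans (mul_le_mul_of_nonneg_left (hcl a b) K.2)
  · have h1 := hlip _ (hmem t) 0 ⟨le_rfl, zero_le_one⟩
    have h2 : |max 0 (min 1 t) - 0| ≤ 1 := by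
      rw [sub_zero, abs_of_nonneg (hmem t).1]; exact (hmem t).2
    have h3 : (K : ℝ) * |max 0 (min 1 t) - 0| ≤ K * 1 := mul_le_mul_of_nonneg_left h2 K.2
    have h4 := abs_sub_abs_le_abs_sub (x₀ (max 0 (min 1 t))) (x₀ 0)
    rw [abs_of_pos hpos] at h4
    simp only [zero_le_one, inf_of_le_right, max_self]
    linarith
  · simpa using hpos

/-- The spline with coefficients that solve the discrete equation solves the discretized Lavrent'ev
equation. -/
theorem solvesDiscreteLavrentiev_spline (hm : 0 < m) {α xs : ℝ} {y : ℝ → ℝ} {a : ℕ → ℝ}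
    (ha : ∀ i < m, α * (xs - a i) + cellMean m i y = splineAutoconv m a i) :
    SolvesDiscreteLavrentiev m α xs y (spline m a) := by
  intro s _
  have hi := cellIndex_lt hm s
  rw [splineProj_spline hm, splineProj, splineProj, splineProj, cellMean_autoconv_spline a hi,
    ← ha _ hi, show (fun t => xs - spline m a t) = spline m fun j => xs - a j from rfl,
    cellMean_spline hm _ hi]

end Autoconv

theorem mainTheorem2 (x₀ : ℝ → ℝ) (hx₀ : Autoconv.IsAdmissibleSolution x₀) :
    ∃ σ > (0 : ℝ), ∃ c > (0 : ℝ), ∃ C > (0 : ℝ),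
      ∀ (δ : ℝ) (m : ℕ) (yδ : ℝ → ℝ), 0 < δ → δ ≤ 1 → 1 ≤ (m : ℝ) * δ →
        Autoconv.IsNoisyData x₀ yδ δ →
        ∃ x ∈ Autoconv.splineSpace m,
          Autoconv.SolvesDiscreteLavrentiev m (c * Real.sqrt δ)
            (Autoconv.refValue m δ yδ) yδ x ∧
          Autoconv.weightedNorm σ (fun t => x₀ t - x t) ≤ c * Real.sqrt δ ∧
          Autoconv.l2Norm (fun t => x₀ t - x t) ≤ C * Real.sqrt δ := by
  open Autoconv in
  obtain ⟨u, L, hL, hxu, hu, hM, hu0⟩ := hx₀.exists_lipschitz_extension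
  set M := u 0 + L with hMdef
  have hM0 : 0 < M := by positivity
  set B := (1 + u 0 ^ 2 + 8 * M * L) / u 0 with hB
  have hB0 : 0 < B := by positivity
  -- The weight is chosen first; then `c` is chosen large enough to absorb the errors of the data,
  -- of the reference value and of the discretization.
  set σ := 1 + 8 * L / u 0 + 512 * L ^ 2 / u 0 ^ 2 with hσ
  have hσ0 : 0 < σ := by positivity
  set c := 1 + 8 * M + 64 * B + 64 * (1 + 2 * M * L) with hc
  have hML : 0 ≤ M * L := by positivity
  have hc0 : 0 < c := by positivity
  refine ⟨σ, hσ0, c, hc0, Real.exp σ * c, by positivity, ?_⟩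
  intro δ m y hδ hδ1 hmδ hy
  have hm : 0 < m := by
    rcases Nat.eq_zero_or_pos m with rfl | h
    · norm_num at hmδ
    · exact h
  have h2 : (0 : ℝ) < m := by exact_mod_cast hm
  have hs : 0 < √δ := Real.sqrt_pos.2 hδ
  have hsq : √δ * √δ = δ := Real.mul_self_sqrt hδ.le
  have hs1 : √δ ≤ 1 := Real.sqrt_le_one.2 hδ1
  have hδs : δ ≤ √δ := by nlinarith
  set α := c * √δ with hα
  have hα0 : 0 < α := by positivity
  have hy' : IsNoisyData u y δ := by
    refine ⟨hy.1, ?_⟩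
    filter_upwards [hy.2, ae_restrict_mem measurableSet_Ioo] with s h1 h3
    rwa [← autoconv_congr hxu (Ioo_subset_Icc_self h3)]
  have h1m : 1 / (m : ℝ) ≤ δ := by rw [div_le_iff₀ h2]; linarith
  have hLm : L / m ≤ L * δ := by rw [div_eq_mul_one_div]; gcongr
  have hLα : L / m ≤ α / 8 := by
    calc L / m ≤ L * √δ := hLm.trans (by gcongr)
      _ ≤ c / 8 * √δ := by gcongr; linarith
      _ = α / 8 := by rw [hα]; ring
  obtain ⟨a, ha, hab⟩ : ∃ a : ℕ → ℝ,
      (∀ i < m, α * (refValue m δ y - a i) + cellMean m i y = splineAutoconv m a i) ∧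
      ∑ i ∈ Finset.range m, (Real.exp (-(σ / m)) ^ i * (a i - u (i / m))) ^ 2 ≤
        m * (α / 8) ^ 2 := by
    refine exists_discrete_solution (p := fun j => u (j / m)) (y := fun i => cellMean m i y)
      (L := L) hm hσ0 hα0 hL (by simpa using hu0) (fun j => ?_) ?_ ?_ ?_ ?_ ?_
    · refine (hu _ _).trans (le_of_eq ?_)
      rw [← sub_div]
      push_cast
      rw [add_sub_cancel_left, abs_of_pos (by positivity)]
      ring
    · simp only [Nat.cast_zero, zero_div]
      have h3 : 8 * L / u 0 * u 0 = 8 * L := div_mul_cancel₀ _ hu0.ne'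
      have h4 : 0 ≤ 512 * L ^ 2 / u 0 ^ 2 * u 0 := by positivity
      rw [hσ]
      linarith
    · simp only [Nat.cast_zero, zero_div]
      have h3 : 512 * L ^ 2 / u 0 ^ 2 * u 0 ^ 2 = 512 * L ^ 2 := div_mul_cancel₀ _ (by positivity)
      have h4 : 0 ≤ 8 * L / u 0 * u 0 ^ 2 := by positivity
      rw [hσ]
      nlinarith [sq_nonneg (u 0)]
    · simp only [Nat.cast_zero, zero_div]
      have h3 : 1 ≤ √δ * m := hmδ.trans (by rw [mul_comm]; gcongr)
      calc 8 * (u 0 + L) ≤ c * 1 := by rw [← hMdef]; linarith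
        _ ≤ c * (√δ * m) := by gcongr
        _ = α * m := by rw [hα]; ring
    · simp only [Nat.cast_zero, zero_div]
      refine (abs_refValue_sub_le hm hL hu hM hu0 hδ hδ1 hmδ hy').trans ?_
      calc B * √δ ≤ c / 64 * √δ := by gcongr; linarith
        _ = α / 64 := by rw [hα]; ring
    · intro i hi
      refine (abs_cellMean_sub_splineAutoconv_le hm hL hu hM hy' hi).trans ?_
      have hc1 : 1 ≤ c := by linarith
      calc δ + 2 * M * (L / m) ≤ δ + 2 * M * (L * δ) := by gcongr
        _ = (1 + 2 * M * L) * δ := by ring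
        _ ≤ c / 64 * δ := by gcongr; linarith
        _ ≤ c * c / 64 * δ := by gcongr; nlinarith
        _ = α ^ 2 / 64 := by rw [hα, mul_pow, pow_two √δ, hsq]; ring
  refine ⟨spline m a, spline_mem m a, solvesDiscreteLavrentiev_spline hm ha, ?_, ?_⟩
  · rw [weightedNorm, Real.sqrt_le_left hα0.le]
    have h3 := integral_mul_sq_sub_spline_le (κ := 1) hm hL hu hσ0.le zero_le_one hxu
      (w := fun t => Real.exp (-2 * σ * t)) (fun t _ => (Real.exp_pos _).le)
      (fun t _ => (one_mul _).ge) hLα hab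
    rwa [one_mul] at h3
  · rw [l2Norm, Real.sqrt_le_left (by positivity)]
    have h3 := integral_mul_sq_sub_spline_le (κ := Real.exp σ ^ 2) hm hL hu hσ0.le (by positivity)
      hxu (w := fun _ => 1) (fun t _ => zero_le_one) (fun t ht => ?_) hLα hab
    · simp only [one_mul] at h3
      refine h3.trans (le_of_eq ?_)
      rw [hα]
      ring
    · rw [← Real.exp_nat_mul, ← Real.exp_add, Real.one_le_exp_iff]
      push_cast
      nlinarith [ht.2]
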